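/- \textbf{Setting.} Let $M$ be a closed (compact, without boundary), connected smooth manifold of dimension $m$, $\Sigma\subset TM$ a smooth distribution of rank $k$, and $g_c$ a smooth inner product on $\Sigma$. Given a smooth complement $\Sigma'$, $TM=\Sigma\oplus\Sigma'$, let $\mathcal P$ denote the projection onto $\Sigma$ along $\Sigma'$ and let $D$ be the horizontal connection, i.e. the unique connection on $\Sigma$ (differentiating sections of $\Sigma$ along $\Sigma$) such that for all sections $X,Y,Z$ of $\Sigma$ $$Xg_c(Y,Z)=g_c(D_XY,Z)+g_c(Y,D_XZ),\qquad D_XY-D_YX=\mathcal P[X,Y].$$ Let $\nabla^{\mathcal H}u$ be the section of $\Sigma$ with $g_c(\nabla^{\mathcal H}u,X)=Xu$ for all sections $X$ of $\Sigma$, let $\mathrm{div}^{\mathcal H}X=\sum_{i=1}^k g_c(D_{X_i}X,X_i)$ for an orthonormal basis $X_1,\dots,X_k$ of $\Sigma$, and put $\Delta^{\mathcal H}=\mathrm{div}^{\mathcal H}\circ\nabla^{\mathcal H}$. The operator $\Delta^{\mathcal H}$ is called a \emph{sublaplacian} of $(M,\Sigma,g_c)$ if $\Sigma'$ is such that, for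 some Riemannian metric $g$ on $M$ which extends $g_c$ and makes $\Sigma$ and $\Sigma'$ orthogonal, $\Sigma'$ has around every point a smooth $g$-orthonormal frame $(T_\beta)$ with $\mathcal P(\nabla_{T_\beta}T_\beta)=0$ for every $\beta$, where $\nabla$ is the Levi-Civita connection of $g$. The distribution $\Sigma$ satisfies the \emph{H\"ormander condition} if for every $p\in M$ there is an $r$ such that the values at $p$ of the iterated commutators of order at most $r$ of smooth sections of $\Sigma$ span $T_pM$ (sections themselves having order $1$). \textbf{Theorem.} Suppose that $\Sigma$ satisfies the H\"ormander condition, and let $\Delta^{\mathcal H}$ be a sublaplacian of $(M,\Sigma,g_c)$. Then every $C^2$ function $u:M\to\mathbb R$ with $\Delta^{\mathcal H}u=0$ on $M$ is constant. -/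

import Mathlib

open scoped Manifold ContDiff Topology
open Bundle Module VectorField

noncomputable section

namespace SubRiem

/-- A vector field on an `m`-dimensional manifold `M` (no regularity included). -/
abbrev VField (m : ℕ) (M : Type*) [TopologicalSpace M]
    [ChartedSpace (EuclideanSpace ℝ (Fin m)) M] : Type _ :=
  (x : M) → TangentSpace (𝓡 m) x

variable {m k l : ℕ} {M : Type*} [TopologicalSpace M]
  [ChartedSpace (EuclideanSpace ℝ (Fin m)) M]

/-- The vector field `X` is smooth on the set `U`. -/
def SmoothOn [IsManifold (𝓡 m) ∞ M] (X : VField m M) (U : Set M) : Prop :=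
  ContMDiffOn (𝓡 m) (𝓡 m).tangent ∞ (fun x => (⟨x, X x⟩ : TangentBundle (𝓡 m) M)) U

/-- The vector field `X` is differentiable at the point `x`. -/
def DiffAt [IsManifold (𝓡 m) ∞ M] (X : VField m M) (x : M) : Prop :=
  MDifferentiableAt (𝓡 m) (𝓡 m).tangent (fun y => (⟨y, X y⟩ : TangentBundle (𝓡 m) M)) x

/-- The vector fields `X i` form a smooth frame on `U` of the family of subspaces `V`. -/
structure IsFrameOn [IsManifold (𝓡 m) ∞ M] (V : (x : M) → Submodule ℝ (TangentSpace (𝓡 m) x))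
    (X : Fin k → VField m M) (U : Set M) : Prop where
  smoothOn : ∀ i, SmoothOn (X i) U
  linearIndependent : ∀ x ∈ U, LinearIndependent ℝ (fun i => X i x)
  span_eq : ∀ x ∈ U, Submodule.span ℝ (Set.range (fun i => X i x)) = V x

/-- A smooth distribution of rank `k`: a smooth rank `k` subbundle of the tangent bundle. -/
structure Distribution (m k : ℕ) (M : Type*) [TopologicalSpace M]
    [ChartedSpace (EuclideanSpace ℝ (Fin m)) M] [IsManifold (𝓡 m) ∞ M] where
  space : (x : M) → Submodule ℝ (TangentSpace (𝓡 m) x)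
  exists_frame : ∀ p : M, ∃ U : Set M, IsOpen U ∧ p ∈ U ∧
    ∃ X : Fin k → VField m M, IsFrameOn space X U

theorem mdifferentiableAt_sum {ι F : Type*} [NormedAddCommGroup F] [NormedSpace ℝ F] (s : Finset ι)
    (f : ι → M → F) (p : M) (hf : ∀ i ∈ s, MDifferentiableAt (𝓡 m) 𝓘(ℝ, F) (f i) p) :
    MDifferentiableAt (𝓡 m) 𝓘(ℝ, F) (fun y => ∑ i ∈ s, f i y) p := by
  classical
  induction s using Finset.induction_on with
  | empty => simpa using mdifferentiableAt_const
  | insert a s ha ih =>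
    simp only [Finset.sum_insert ha]
    exact (hf a (by simp)).add (ih fun i hi => hf i (by simp [hi]))

variable [IsManifold (𝓡 m) ∞ M]

/-- Sections of a distribution (no regularity included). -/
abbrev Distribution.Sec (D : Distribution m k M) : Type _ := (x : M) → D.space x

/-- A section of a distribution, seen as a vector field. -/
def Distribution.Sec.toVField {D : Distribution m k M} (X : D.Sec) : VField m M :=
  fun x => (X x : TangentSpace (𝓡 m) x)

/-- Vector fields that are iterated commutators of `n` smooth sections of `D`. -/
inductive Distribution.IsCommutator (D : Distribution m k M) : ℕ → VField m M → Prop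
  | section_ (X : D.Sec) (hX : SmoothOn X.toVField Set.univ) : D.IsCommutator 1 X.toVField
  | bracket {i j : ℕ} {X Y : VField m M} (hX : D.IsCommutator i X) (hY : D.IsCommutator j Y) :
      D.IsCommutator (i + j) (mlieBracket (𝓡 m) X Y)

/-- The span at `p` of all commutators of order at most `r` of smooth sections of `D`. -/
def Distribution.flag (D : Distribution m k M) (r : ℕ) (p : M) :
    Submodule ℝ (TangentSpace (𝓡 m) p) :=
  Submodule.span ℝ {v | ∃ i ≤ r, ∃ X : VField m M, D.IsCommutator i X ∧ X p = v}

/-- The Hörmander (Chow, bracket generating) condition. -/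
def Distribution.Hormander (D : Distribution m k M) : Prop :=
  ∀ p : M, ∃ r : ℕ, D.flag r p = ⊤

/-- A sub-Riemannian structure of rank `k`: a smooth distribution of rank `k` together with
a smooth field of inner products on it. -/
structure SubRiemannianStructure (m k : ℕ) (M : Type*) [TopologicalSpace M]
    [ChartedSpace (EuclideanSpace ℝ (Fin m)) M] [IsManifold (𝓡 m) ∞ M]
    extends Distribution m k M where
  metric : (x : M) → LinearMap.BilinForm ℝ (space x)
  symm : ∀ x v w, metric x v w = metric x w v
  pos : ∀ x v, v ≠ 0 → 0 < metric x v v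
  smooth : ∀ (U : Set M), IsOpen U → ∀ X Y : toDistribution.Sec,
    SmoothOn X.toVField U → SmoothOn Y.toVField U →
      ContMDiffOn (𝓡 m) 𝓘(ℝ, ℝ) ∞ (fun x => metric x (X x) (Y x)) U

/-- A smooth complement of rank `l` of the distribution `D`. -/
structure Complement (D : Distribution m k M) (l : ℕ) extends Distribution m l M where
  isCompl : ∀ x, IsCompl (D.space x) (space x)

/-- The projection of the tangent space onto `D` along the complement `C`. -/
def Complement.proj {D : Distribution m k M} (C : Complement D l) (x : M) :
    TangentSpace (𝓡 m) x →ₗ[ℝ] D.space x :=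
  Submodule.projectionOnto (D.space x) (C.space x) (C.isCompl x)

namespace SubRiemannianStructure

variable (S : SubRiemannianStructure m k M)

theorem nondegenerate (x : M) : (S.metric x).Nondegenerate := by
  constructor <;> intro v hv <;> by_contra h <;> exact absurd (hv v) (S.pos x v h).ne'

/-- The horizontal gradient: `g_c(∇ᴴ u, v) = v u` for all horizontal vectors `v`. -/
def horizontalGradient (u : M → ℝ) : S.Sec := fun x =>
  haveI : FiniteDimensional ℝ (TangentSpace (𝓡 m) x) :=
    inferInstanceAs (FiniteDimensional ℝ (EuclideanSpace ℝ (Fin m)))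
  ((S.metric x).toDual (S.nondegenerate x)).symm
    ((mvfderiv (𝓡 m) u x).toLinearMap ∘ₗ (S.space x).subtype)

end SubRiemannianStructure

/-- `D` is a horizontal connection of `S` for the splitting given by `C`, where `D Y x v` stands
for `D_v Y` at `x`: a connection on the distribution (additive and Leibniz in `Y`, linear in `v`)
which satisfies `X g_c(Y, Z) = g_c(D_X Y, Z) + g_c(Y, D_X Z)` and `D_X Y - D_Y X = [X, Y]ᴴ`. -/
structure IsHorizontalConnection (S : SubRiemannianStructure m k M)
    (C : Complement S.toDistribution l)
    (D : S.Sec → (x : M) → (S.space x →ₗ[ℝ] S.space x)) : Prop where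
  add : ∀ (Y Z : S.Sec) (x : M), DiffAt Y.toVField x → DiffAt Z.toVField x →
    D (Y + Z) x = D Y x + D Z x
  leibniz : ∀ (f : M → ℝ) (Y : S.Sec) (x : M), MDifferentiableAt (𝓡 m) 𝓘(ℝ, ℝ) f x →
    DiffAt Y.toVField x → ∀ v : S.space x,
      D (fun y => f y • Y y) x v = f x • D Y x v + (mvfderiv (𝓡 m) f x v) • Y x
  metric : ∀ (X Y Z : S.Sec) (x : M), DiffAt X.toVField x → DiffAt Y.toVField x →
    DiffAt Z.toVField x →
    mvfderiv (𝓡 m) (fun y => S.metric y (Y y) (Z y)) x (X x) =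
      S.metric x (D Y x (X x)) (Z x) + S.metric x (Y x) (D Z x (X x))
  torsion : ∀ (X Y : S.Sec) (x : M), DiffAt X.toVField x → DiffAt Y.toVField x →
    D Y x (X x) - D X x (Y x) = C.proj x (mlieBracket (𝓡 m) X.toVField Y.toVField x)



theorem exists_coeffs {ι : Type} [Fintype ι] (p : M) (e : ι → VField m M) (he : ∀ i, DiffAt (e i) p)
    (hb : ∀ᶠ y in 𝓝 p, LinearIndependent ℝ (fun i => e i y) ∧
      Submodule.span ℝ (Set.range (fun i => e i y)) = ⊤) (X : VField m M) (hX : DiffAt X p) :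
    ∃ c : ι → M → ℝ, (∀ i, MDifferentiableAt (𝓡 m) 𝓘(ℝ, ℝ) (c i) p) ∧
      ∀ᶠ y in 𝓝 p, X y = ∑ i, c i y • e i y := by
  classical
  let φ := trivializationAt (EuclideanSpace ℝ (Fin m)) (TangentSpace (𝓡 m) : M → Type _) p
  have hφ : ∀ᶠ y in 𝓝 p, y ∈ φ.baseSet :=
    φ.open_baseSet.mem_nhds (FiberBundle.mem_baseSet_trivializationAt' p)
  have hφe : ∀ i, MDifferentiableAt (𝓡 m) 𝓘(ℝ, EuclideanSpace ℝ (Fin m))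
      (fun y => (φ ⟨y, e i y⟩).2) p := fun i => (mdifferentiableAt_section _ _).1 (he i)
  have hφX : MDifferentiableAt (𝓡 m) 𝓘(ℝ, EuclideanSpace ℝ (Fin m))
      (fun y => (φ ⟨y, X y⟩).2) p := (mdifferentiableAt_section _ _).1 hX
  let R : ι → EuclideanSpace ℝ (Fin m) →L[ℝ] ((ι → ℝ) →L[ℝ] EuclideanSpace ℝ (Fin m)) := fun i =>
    ContinuousLinearMap.smulRightL ℝ _ _
      (ContinuousLinearMap.proj (R := ℝ) (φ := fun _ : ι => ℝ) i)
  let A : M → ((ι → ℝ) →L[ℝ] EuclideanSpace ℝ (Fin m)) := fun y => ∑ i, R i (φ ⟨y, e i y⟩).2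
  have hA : MDifferentiableAt (𝓡 m) 𝓘(ℝ, (ι → ℝ) →L[ℝ] EuclideanSpace ℝ (Fin m)) A p :=
    mdifferentiableAt_sum _ _ p fun i _ =>
      (R i).differentiableAt.comp_mdifferentiableAt (hφe i)
  have hbij : ∀ y ∈ φ.baseSet, (LinearIndependent ℝ (fun i => e i y) ∧
      Submodule.span ℝ (Set.range (fun i => e i y)) = ⊤) → (A y).IsInvertible := by
    intro y hy ⟨h1, h2⟩
    let B := Basis.mk h1 h2.ge
    let Ψ : (ι → ℝ) ≃ₗ[ℝ] EuclideanSpace ℝ (Fin m) :=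
      B.equivFun.symm.trans (φ.linearEquivAt ℝ y hy)
    refine ⟨Ψ.toContinuousLinearEquiv, ?_⟩
    ext a j
    simp [Ψ, A, R, B, Basis.equivFun_symm_apply]
  have hinv : MDifferentiableAt (𝓡 m) 𝓘(ℝ, EuclideanSpace ℝ (Fin m) →L[ℝ] (ι → ℝ))
      (fun y => (A y).inverse) p :=
    (((hbij p hφ.self_of_nhds hb.self_of_nhds).contDiffAt_map_inverse
      (n := 1)).differentiableAt one_ne_zero).comp_mdifferentiableAt hA
  have hc := hinv.clm_apply hφX
  refine ⟨fun i y => (A y).inverse (φ ⟨y, X y⟩).2 i, fun i => ?_, ?_⟩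
  · exact (ContinuousLinearMap.proj (R := ℝ) (φ := fun _ : ι => ℝ) i).differentiableAt.comp_mdifferentiableAt hc
  · filter_upwards [hφ, hb] with y hy hby
    apply (φ.linearEquivAt ℝ y hy).injective
    obtain ⟨Ψ, hΨ⟩ := hbij y hy hby
    have h1 : A y ((A y).inverse (φ ⟨y, X y⟩).2) = (φ ⟨y, X y⟩).2 := by
      rw [← hΨ]; simp
    simp only [map_sum, map_smul]
    refine Eq.trans h1.symm ?_
    simp [A, R]

theorem Distribution.exists_sec_frame (D : Distribution m k M) (p : M) :
    ∃ e : Fin k → D.Sec, (∃ U : Set M, IsOpen U ∧ p ∈ U ∧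
      IsFrameOn D.space (fun i => (e i).toVField) U) := by
  classical
  obtain ⟨U, hU, hp, X, hX⟩ := D.exists_frame p
  have hmem : ∀ y ∈ U, ∀ i, X i y ∈ D.space y := fun y hy i => by
    rw [← hX.span_eq y hy]; exact Submodule.subset_span ⟨i, rfl⟩
  refine ⟨fun i y => if h : X i y ∈ D.space y then ⟨X i y, h⟩ else 0, U, hU, hp, ?_⟩
  have heq : ∀ y ∈ U, ∀ i, Distribution.Sec.toVField (D := D)
      (fun y => if h : X i y ∈ D.space y then ⟨X i y, h⟩ else 0) y = X i y := fun y hy i => by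
    simp [Distribution.Sec.toVField, hmem y hy i]
  refine ⟨fun i => ?_, fun y hy => ?_, fun y hy => ?_⟩
  · exact (hX.smoothOn i).congr fun y hy => by simp [heq y hy i]
  · simpa only [heq y hy] using hX.linearIndependent y hy
  · simpa only [heq y hy] using hX.span_eq y hy

theorem SmoothOn.diffAt {X : VField m M} {U : Set M} (h : SmoothOn X U) (hU : IsOpen U) {p : M}
    (hp : p ∈ U) : DiffAt X p :=
  (h.contMDiffAt (hU.mem_nhds hp)).mdifferentiableAt (by simp)

variable {S : SubRiemannianStructure m k M}

theorem Complement.proj_coeffs {D : Distribution m k M} (C : Complement D l) (p : M) :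
    ∃ e : Fin k → D.Sec, (∃ U : Set M, IsOpen U ∧ p ∈ U ∧
      IsFrameOn D.space (fun i => (e i).toVField) U) ∧
      ∀ X : VField m M, DiffAt X p → ∃ c : Fin k → M → ℝ,
        (∀ i, MDifferentiableAt (𝓡 m) 𝓘(ℝ, ℝ) (c i) p) ∧
        ∀ᶠ y in 𝓝 p, C.proj y (X y) = ∑ i, c i y • e i y := by
  obtain ⟨e, U, hU, hp, he⟩ := D.exists_sec_frame p
  obtain ⟨f, V, hV, hq, hf⟩ := C.toDistribution.exists_sec_frame p
  refine ⟨e, ⟨U, hU, hp, he⟩, fun X hX => ?_⟩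
  obtain ⟨c, hc, hcX⟩ := exists_coeffs p
    (Sum.elim (fun i => (e i).toVField) (fun i => (f i).toVField)) (by
      rintro (i | i)
      · exact (he.smoothOn i).diffAt hU hp
      · exact (hf.smoothOn i).diffAt hV hq) (by
      filter_upwards [hU.mem_nhds hp, hV.mem_nhds hq] with y hy hy'
      have e1 : (fun i => Sum.elim (fun i => (e i).toVField) (fun i => (f i).toVField) i y) =
        Sum.elim (fun i => (e i).toVField y) (fun i => (f i).toVField y) := by
          ext1 (i | i) <;> rfl
      rw [e1]
      constructor
      · refine (he.linearIndependent y hy).sum_type (hf.linearIndependent y hy') ?_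
        rw [he.span_eq y hy, hf.span_eq y hy']
        exact (C.isCompl y).disjoint
      · rw [Set.Sum.elim_range, Submodule.span_union, he.span_eq y hy, hf.span_eq y hy']
        exact (C.isCompl y).sup_eq_top) X hX
  refine ⟨fun i => c (Sum.inl i), fun i => hc _, ?_⟩
  filter_upwards [hcX] with y hy
  rw [hy]
  have h1 : ∀ i, C.proj y ((e i).toVField y) = e i y := fun i =>
    Submodule.projectionOnto_apply_left _ (e i y)
  have h2 : ∀ i, C.proj y ((f i).toVField y) = 0 := fun i =>
    Submodule.projectionOnto_apply_right _ (f i y)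
  simp [h1, h2]

theorem Complement.diffAt_proj {D : Distribution m k M} (C : Complement D l) {p : M}
    {X : VField m M} (hX : DiffAt X p) :
    DiffAt (Distribution.Sec.toVField (D := D) fun y => C.proj y (X y)) p := by
  obtain ⟨e, ⟨U, hU, hp, he⟩, h⟩ := C.proj_coeffs p
  obtain ⟨c, hc, hcX⟩ := h X hX
  have : DiffAt (fun y => ∑ i, c i y • (e i).toVField y) p :=
    MDifferentiableAt.sum_section fun i _ =>
      (hc i).smul_section ((he.smoothOn i).diffAt hU hp)
  refine MDifferentiableAt.congr_of_eventuallyEq this ?_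
  filter_upwards [hcX] with y hy
  simp [Distribution.Sec.toVField, hy]

theorem Complement.proj_sec {D : Distribution m k M} (C : Complement D l) (X : D.Sec) (y : M) :
    C.proj y (X.toVField y) = X y := Submodule.projectionOnto_apply_left _ (X y)

theorem Complement.diffAt_metric (C : Complement S.toDistribution l) {p : M}
    {X Y : S.Sec} (hX : DiffAt X.toVField p) (hY : DiffAt Y.toVField p) :
    MDifferentiableAt (𝓡 m) 𝓘(ℝ, ℝ) (fun y => S.metric y (X y) (Y y)) p := by
  obtain ⟨e, ⟨U, hU, hp, he⟩, h⟩ := C.proj_coeffs p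
  obtain ⟨c, hc, hcX⟩ := h _ hX
  obtain ⟨d, hd, hdY⟩ := h _ hY
  have : MDifferentiableAt (𝓡 m) 𝓘(ℝ, ℝ)
      (fun y => ∑ i, ∑ j, c i y * (d j y * S.metric y (e i y) (e j y))) p :=
    mdifferentiableAt_sum _ _ p fun i _ => mdifferentiableAt_sum _ _ p fun j _ =>
      (hc i).mul ((hd j).mul (((S.smooth U hU _ _ (he.smoothOn i) (he.smoothOn j)).contMDiffAt
        (hU.mem_nhds hp)).mdifferentiableAt (by simp)))
  refine MDifferentiableAt.congr_of_eventuallyEq this ?_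
  filter_upwards [hcX, hdY] with y hy hy'
  rw [C.proj_sec] at hy hy'
  simp only [hy, hy', map_sum, LinearMap.sum_apply, map_smul, LinearMap.smul_apply, smul_eq_mul,
    Finset.mul_sum]
  rw [Finset.sum_comm]
  refine Finset.sum_congr rfl fun i _ => Finset.sum_congr rfl fun j _ => by ring

theorem DiffAt.add {D : Distribution m k M} {X Y : D.Sec} {x : M} (hX : DiffAt X.toVField x)
    (hY : DiffAt Y.toVField x) : DiffAt (Distribution.Sec.toVField (X + Y)) x :=
  mdifferentiableAt_add_section hX hY

theorem DiffAt.smul {D : Distribution m k M} {f : M → ℝ} {X : D.Sec} {x : M}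
    (hf : MDifferentiableAt (𝓡 m) 𝓘(ℝ, ℝ) f x) (hX : DiffAt X.toVField x) :
    DiffAt (Distribution.Sec.toVField (D := D) fun y => f y • X y) x :=
  MDifferentiableAt.smul_section hf hX

/-- The horizontal part of the Lie bracket of two sections. -/
def Complement.hbracket {D : Distribution m k M} (C : Complement D l) (X Y : D.Sec) : D.Sec :=
  fun x => C.proj x (mlieBracket (𝓡 m) X.toVField Y.toVField x)

theorem Complement.hbracket_swap {D : Distribution m k M} (C : Complement D l) (X Y : D.Sec)
    (x : M) : C.hbracket X Y x = -C.hbracket Y X x := by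
  rw [hbracket, mlieBracket_swap_apply, map_neg]; rfl

theorem Complement.hbracket_add {D : Distribution m k M} (C : Complement D l) {X Y Z : D.Sec}
    {x : M} (hY : DiffAt Y.toVField x) (hZ : DiffAt Z.toVField x) :
    C.hbracket X (Y + Z) x = C.hbracket X Y x + C.hbracket X Z x := by
  have : IsManifold (𝓡 m) 2 M := IsManifold.of_le (n := ∞) ENat.LEInfty.out
  have h := mlieBracket_add_right (I := 𝓡 m) (V := X.toVField) hY hZ
  rw [hbracket, hbracket, hbracket, ← map_add, ← h]; rfl

theorem Complement.hbracket_smul {D : Distribution m k M} (C : Complement D l) {f : M → ℝ}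
    {X Y : D.Sec} {x : M} (hf : MDifferentiableAt (𝓡 m) 𝓘(ℝ, ℝ) f x)
    (hY : DiffAt Y.toVField x) :
    C.hbracket X (fun y => f y • Y y) x =
      mvfderiv (𝓡 m) f x (X x) • Y x + f x • C.hbracket X Y x := by
  have : IsManifold (𝓡 m) 2 M := IsManifold.of_le (n := ∞) ENat.LEInfty.out
  have h := mlieBracket_smul_right (I := 𝓡 m) (V := X.toVField) hf hY
  have h2 := congrArg (C.proj x) h
  rw [map_add, map_smul, map_smul, C.proj_sec] at h2
  exact h2

/-- The derivative of `g_c(X, Y)` at `x`. -/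
def SubRiemannianStructure.dmetric (S : SubRiemannianStructure m k M) (X Y : S.Sec) (x : M) :
    TangentSpace (𝓡 m) x →L[ℝ] ℝ :=
  mvfderiv (𝓡 m) (fun y => S.metric y (X y) (Y y)) x

theorem SubRiemannianStructure.dmetric_symm (X Y : S.Sec) (x : M) :
    S.dmetric X Y x = S.dmetric Y X x := by
  simp only [dmetric, S.symm _ (X _) (Y _)]

theorem Complement.dmetric_add (C : Complement S.toDistribution l) {X Y Z : S.Sec} {x : M}
    (hX : DiffAt X.toVField x) (hY : DiffAt Y.toVField x) (hZ : DiffAt Z.toVField x) :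
    S.dmetric X (Y + Z) x = S.dmetric X Y x + S.dmetric X Z x := by
  have := mvfderiv_fun_add (C.diffAt_metric hX hY) (C.diffAt_metric hX hZ)
  simpa [SubRiemannianStructure.dmetric] using this

theorem Complement.dmetric_smul (C : Complement S.toDistribution l) {f : M → ℝ} {X Y : S.Sec}
    {x : M} (hf : MDifferentiableAt (𝓡 m) 𝓘(ℝ, ℝ) f x)
    (hX : DiffAt X.toVField x) (hY : DiffAt Y.toVField x) (v : TangentSpace (𝓡 m) x) :
    S.dmetric X (fun y => f y • Y y) x v =
      f x * S.dmetric X Y x v + mvfderiv (𝓡 m) f x v * S.metric x (X x) (Y x) := by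
  have := congrArg (fun L => L v) (mvfderiv_fun_mul hf (C.diffAt_metric hX hY))
  simp [SubRiemannianStructure.dmetric] at this ⊢
  rw [this]; ring

/-- The right hand side of the Koszul formula. -/
def Complement.koszul (C : Complement S.toDistribution l) (X Y Z : S.Sec) (x : M) : ℝ :=
  S.dmetric Y Z x (X x) + S.dmetric X Z x (Y x) - S.dmetric X Y x (Z x)
    + S.metric x (C.hbracket X Y x) (Z x) - S.metric x (C.hbracket X Z x) (Y x)
    - S.metric x (C.hbracket Y Z x) (X x)

section koszul

variable (C : Complement S.toDistribution l) {X Y Z W : S.Sec} {f : M → ℝ} {x : M}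

theorem Complement.koszul_metric : C.koszul X Y Z x + C.koszul X Z Y x =
    2 * S.dmetric Y Z x (X x) := by
  simp only [koszul, S.dmetric_symm Z Y, C.hbracket_swap Z Y, map_neg,
    LinearMap.neg_apply]
  ring

theorem Complement.koszul_torsion : C.koszul X Y Z x - C.koszul Y X Z x =
    2 * S.metric x (C.hbracket X Y x) (Z x) := by
  simp only [koszul, S.dmetric_symm Y X, C.hbracket_swap Y X, map_neg,
    LinearMap.neg_apply]
  ring

theorem Complement.koszul_add_mid (hX : DiffAt X.toVField x) (hY : DiffAt Y.toVField x)
    (hZ : DiffAt Z.toVField x) (hW : DiffAt W.toVField x) :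
    C.koszul X (Y + W) Z x = C.koszul X Y Z x + C.koszul X W Z x := by
  simp only [koszul, S.dmetric_symm _ Z, C.dmetric_add hZ hY hW, C.dmetric_add hX hY hW,
    C.hbracket_swap _ Z, C.hbracket_add hY hW, Pi.add_apply, map_add, map_neg,
    LinearMap.add_apply, LinearMap.neg_apply, _root_.add_apply, Submodule.coe_add]
  ring

theorem Complement.koszul_smul_mid (hX : DiffAt X.toVField x) (hY : DiffAt Y.toVField x)
    (hZ : DiffAt Z.toVField x) (hf : MDifferentiableAt (𝓡 m) 𝓘(ℝ, ℝ) f x) :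
    C.koszul X (fun y => f y • Y y) Z x = f x * C.koszul X Y Z x +
      2 * (mvfderiv (𝓡 m) f x (X x) * S.metric x (Y x) (Z x)) := by
  simp only [koszul, S.dmetric_symm _ Z, C.dmetric_smul hf hZ hY, C.dmetric_smul hf hX hY,
    C.hbracket_swap _ Z, C.hbracket_smul hf hY, map_add, map_neg, map_smul, S.symm x (Z x),
    LinearMap.add_apply, LinearMap.neg_apply, LinearMap.smul_apply, Submodule.coe_smul, smul_eq_mul,
    S.symm x (X x)]
  ring

theorem Complement.koszul_add_right (hX : DiffAt X.toVField x) (hY : DiffAt Y.toVField x)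
    (hZ : DiffAt Z.toVField x) (hW : DiffAt W.toVField x) :
    C.koszul X Y (Z + W) x = C.koszul X Y Z x + C.koszul X Y W x := by
  have h1 := C.koszul_metric (X := X) (Y := Y) (Z := Z + W) (x := x)
  have h2 := C.koszul_metric (X := X) (Y := Y) (Z := Z) (x := x)
  have h3 := C.koszul_metric (X := X) (Y := Y) (Z := W) (x := x)
  rw [C.koszul_add_mid hX hZ hY hW, C.dmetric_add hY hZ hW, _root_.add_apply] at h1
  linarith

theorem Complement.koszul_smul_right (hX : DiffAt X.toVField x) (hY : DiffAt Y.toVField x)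
    (hZ : DiffAt Z.toVField x) (hf : MDifferentiableAt (𝓡 m) 𝓘(ℝ, ℝ) f x) :
    C.koszul X Y (fun y => f y • Z y) x = f x * C.koszul X Y Z x := by
  have h1 := C.koszul_metric (X := X) (Y := Y) (Z := fun y => f y • Z y) (x := x)
  have h2 := C.koszul_metric (X := X) (Y := Y) (Z := Z) (x := x)
  rw [C.koszul_smul_mid hX hZ hY hf, C.dmetric_smul hf hY hZ, S.symm x (Z x)] at h1
  linear_combination h1 - f x * h2

theorem Complement.koszul_add_left (hX : DiffAt X.toVField x) (hY : DiffAt Y.toVField x)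
    (hZ : DiffAt Z.toVField x) (hW : DiffAt W.toVField x) :
    C.koszul (X + W) Y Z x = C.koszul X Y Z x + C.koszul W Y Z x := by
  have h1 := C.koszul_torsion (X := Y) (Y := X + W) (Z := Z) (x := x)
  have h2 := C.koszul_torsion (X := Y) (Y := X) (Z := Z) (x := x)
  have h3 := C.koszul_torsion (X := Y) (Y := W) (Z := Z) (x := x)
  rw [C.koszul_add_mid hY hX hZ hW, C.hbracket_add hX hW, map_add, LinearMap.add_apply] at h1
  linarith

theorem Complement.koszul_smul_left (hX : DiffAt X.toVField x) (hY : DiffAt Y.toVField x)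
    (hZ : DiffAt Z.toVField x) (hf : MDifferentiableAt (𝓡 m) 𝓘(ℝ, ℝ) f x) :
    C.koszul (fun y => f y • X y) Y Z x = f x * C.koszul X Y Z x := by
  have h1 := C.koszul_torsion (X := Y) (Y := fun y => f y • X y) (Z := Z) (x := x)
  have h2 := C.koszul_torsion (X := Y) (Y := X) (Z := Z) (x := x)
  rw [C.koszul_smul_mid hY hX hZ hf, C.hbracket_smul hf hX, map_add, map_smul, map_smul,
    LinearMap.add_apply, LinearMap.smul_apply, LinearMap.smul_apply, smul_eq_mul, smul_eq_mul] at h1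
  linear_combination f x * h2 - h1

/-- The section of `D` obtained by projecting a vector field. -/
def Complement.projSec {D : Distribution m k M} (C : Complement D l) (V : VField m M) : D.Sec :=
  fun y => C.proj y (V y)

/-- The Koszul form as a bilinear form in its first and last variable. -/
theorem Complement.exists_koszul_form (hY : DiffAt Y.toVField x) :
    ∃ A : S.space x →ₗ[ℝ] S.space x, ∀ X Z : S.Sec, DiffAt X.toVField x → DiffAt Z.toVField x →
      2 * S.metric x (A (X x)) (Z x) = C.koszul X Y Z x := by
  have : IsManifold (𝓡 m) 1 M := IsManifold.of_le (n := ∞) ENat.LEInfty.out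
  let Φ : VField m M → VField m M → ℝ := fun V W => C.koszul (C.projSec V) Y (C.projSec W) x
  have hadd : ∀ V W, C.projSec (V + W) = C.projSec V + C.projSec W := fun V W => by
    ext1 y; simp [projSec]
  have hsmul : ∀ (f : M → ℝ) V, C.projSec (f • V) = fun y => f y • C.projSec V y := fun f V => by
    ext1 y; simp [projSec]
  have h1 : ∀ W, DiffAt W x → TensorialAt (𝓡 m) (EuclideanSpace ℝ (Fin m)) (Φ · W) x :=
    fun W hW => ⟨fun {f V} hf hV => by
      simp only [Φ, hsmul, smul_eq_mul]
      exact C.koszul_smul_left (C.diffAt_proj hV) hY (C.diffAt_proj hW) hf, fun {V V'} hV hV' => by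
      simp only [Φ, hadd]
      exact C.koszul_add_left (C.diffAt_proj hV) hY (C.diffAt_proj hW) (C.diffAt_proj hV')⟩
  have h2 : ∀ W, DiffAt W x → TensorialAt (𝓡 m) (EuclideanSpace ℝ (Fin m)) (Φ W) x :=
    fun W hW => ⟨fun {f V} hf hV => by
      simp only [Φ, hsmul, smul_eq_mul]
      exact C.koszul_smul_right (C.diffAt_proj hW) hY (C.diffAt_proj hV) hf, fun {V V'} hV hV' => by
      simp only [Φ, hadd]
      exact C.koszul_add_right (C.diffAt_proj hW) hY (C.diffAt_proj hV) (C.diffAt_proj hV')⟩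
  let B := TensorialAt.mkHom₂ Φ x h1 h2
  have hB : ∀ X Z : S.Sec, DiffAt X.toVField x → DiffAt Z.toVField x →
      B (X x) (Z x) = C.koszul X Y Z x := fun X Z hX hZ => by
    have := TensorialAt.mkHom₂_apply h1 h2 hX hZ
    refine this.trans ?_
    have e : ∀ X : S.Sec, C.projSec X.toVField = X := fun X => funext fun y => C.proj_sec X y
    simp only [Φ, e]
  have : FiniteDimensional ℝ (TangentSpace (𝓡 m) x) :=
    inferInstanceAs (FiniteDimensional ℝ (EuclideanSpace ℝ (Fin m)))
  let ρ : (TangentSpace (𝓡 m) x →L[ℝ] ℝ) →ₗ[ℝ] Module.Dual ℝ (S.space x) :=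
    { toFun := fun L => L.toLinearMap ∘ₗ (S.space x).subtype
      map_add' := fun _ _ => rfl
      map_smul' := fun _ _ => rfl }
  refine ⟨(2⁻¹ : ℝ) • (((S.metric x).toDual (S.nondegenerate x)).symm.toLinearMap ∘ₗ ρ ∘ₗ
    B.toLinearMap ∘ₗ (S.space x).subtype), fun X Z hX hZ => ?_⟩
  rw [← hB X Z hX hZ]
  simp [LinearMap.BilinForm.apply_toDual_symm_apply, ρ]

end koszul

theorem Complement.exists_sec {D : Distribution m k M} (C : Complement D l) {x : M}
    (v : D.space x) : ∃ X : D.Sec, DiffAt X.toVField x ∧ X x = v := by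
  have : IsManifold (𝓡 m) 1 M := IsManifold.of_le (n := ∞) ENat.LEInfty.out
  refine ⟨C.projSec (FiberBundle.extend (EuclideanSpace ℝ (Fin m)) (v : TangentSpace (𝓡 m) x)),
    C.diffAt_proj (FiberBundle.mdifferentiableAt_extend ..), ?_⟩
  simp [projSec, proj]

theorem SubRiemannianStructure.eq_of_metric (S : SubRiemannianStructure m k M) {x : M}
    {v w : S.space x} (h : ∀ z, S.metric x v z = S.metric x w z) : v = w := by
  by_contra hne
  have h1 := S.pos x (v - w) (sub_ne_zero.2 hne)
  simp [h] at h1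

/-- Existence of the horizontal connection. -/
theorem exists_isHorizontalConnection (S : SubRiemannianStructure m k M)
    (C : Complement S.toDistribution l) : ∃ D, IsHorizontalConnection S C D := by
  classical
  let D : S.Sec → (x : M) → (S.space x →ₗ[ℝ] S.space x) := fun Y x =>
    if h : DiffAt Y.toVField x then (C.exists_koszul_form h).choose else 0
  have hD : ∀ (X Y Z : S.Sec) (x : M), DiffAt X.toVField x → DiffAt Y.toVField x →
      DiffAt Z.toVField x → 2 * S.metric x (D Y x (X x)) (Z x) = C.koszul X Y Z x :=
    fun X Y Z x hX hY hZ => by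
      have := (C.exists_koszul_form hY).choose_spec X Z hX hZ
      simpa only [D, dif_pos hY] using this
  refine ⟨D, ⟨?_, ?_, ?_, ?_⟩⟩
  · intro Y Z x hY hZ
    ext1 v
    refine S.eq_of_metric fun w => ?_
    obtain ⟨X, hX, rfl⟩ := C.exists_sec v
    obtain ⟨W, hW, rfl⟩ := C.exists_sec w
    have h1 := hD X _ W x hX (hY.add hZ) hW
    rw [C.koszul_add_mid hX hY hW hZ, ← hD X Y W x hX hY hW, ← hD X Z W x hX hZ hW] at h1
    simp only [LinearMap.add_apply, map_add]
    linarith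
  · intro f Y x hf hY v
    refine S.eq_of_metric fun w => ?_
    obtain ⟨X, hX, rfl⟩ := C.exists_sec v
    obtain ⟨W, hW, rfl⟩ := C.exists_sec w
    have h1 := hD X _ W x hX (DiffAt.smul hf hY) hW
    rw [C.koszul_smul_mid hX hY hW hf, ← hD X Y W x hX hY hW] at h1
    simp only [LinearMap.add_apply, map_add, map_smul, LinearMap.smul_apply, smul_eq_mul]
    linarith
  · intro X Y Z x hX hY hZ
    have h1 := hD X Y Z x hX hY hZ
    have h2 := hD X Z Y x hX hZ hY
    have h3 := C.koszul_metric (X := X) (Y := Y) (Z := Z) (x := x)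
    rw [S.symm x (Y x)]
    change S.dmetric Y Z x (X x) = _
    linarith
  · intro X Y x hX hY
    change _ = C.hbracket X Y x
    refine S.eq_of_metric fun w => ?_
    obtain ⟨W, hW, rfl⟩ := C.exists_sec w
    have h1 := hD X Y W x hX hY hW
    have h2 := hD Y X W x hY hX hW
    have h3 := C.koszul_torsion (X := X) (Y := Y) (Z := W) (x := x)
    simp only [map_sub, LinearMap.sub_apply]
    linarith


/-- The horizontal connection of `S` for the splitting given by `C`. Its values on sections that
are differentiable at the point are determined by the properties in `IsHorizontalConnection`. -/
def Complement.horizontalConnection (C : Complement S.toDistribution l) :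
    S.Sec → (x : M) → (S.space x →ₗ[ℝ] S.space x) :=
  (exists_isHorizontalConnection S C).choose

theorem Complement.isHorizontalConnection (C : Complement S.toDistribution l) :
    IsHorizontalConnection S C C.horizontalConnection :=
  (exists_isHorizontalConnection S C).choose_spec

/-- The horizontal divergence `divᴴ X = ∑ i, g_c(D_{X_i} X, X_i)`, for any orthonormal basis
`X_i` of the distribution, that is, the trace of `v ↦ D_v X`. -/
def Complement.horizontalDivergence (C : Complement S.toDistribution l) (X : S.Sec) (x : M) : ℝ :=
  LinearMap.trace ℝ (S.space x) (C.horizontalConnection X x)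

theorem Complement.horizontalDivergence_eq_sum (C : Complement S.toDistribution l) (X : S.Sec)
    (x : M) (b : Basis (Fin k) ℝ (S.space x))
    (hb : ∀ i j, S.metric x (b i) (b j) = if i = j then 1 else 0) :
    C.horizontalDivergence X x =
      ∑ i, S.metric x (C.horizontalConnection X x (b i)) (b i) := by
  rw [horizontalDivergence, LinearMap.trace_eq_matrix_trace ℝ b, Matrix.trace]
  refine Finset.sum_congr rfl fun i _ => ?_
  rw [Matrix.diag_apply, LinearMap.toMatrix_apply]
  have h : ∀ c : Fin k → ℝ, S.metric x (∑ j, c j • b j) (b i) = c i := fun c => by simp [hb]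
  rw [← h (fun j => b.repr (C.horizontalConnection X x (b i)) j), b.sum_repr]

/-- The operator `Δᴴ = divᴴ ∘ ∇ᴴ` for the splitting given by `C`. -/
def Complement.horizontalLaplacian (C : Complement S.toDistribution l) (u : M → ℝ) : M → ℝ :=
  C.horizontalDivergence (S.horizontalGradient u)

/-- Smooth Riemannian metrics on `M`. -/
abbrev Metric (m : ℕ) (M : Type*) [TopologicalSpace M]
    [ChartedSpace (EuclideanSpace ℝ (Fin m)) M] [IsManifold (𝓡 m) ∞ M] : Type _ :=
  ContMDiffRiemannianMetric (𝓡 m) ∞ (EuclideanSpace ℝ (Fin m))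
    (fun x : M => TangentSpace (𝓡 m) x)

/-- Connections (covariant derivatives) on the tangent bundle of `M`. -/
abbrev Connection (m : ℕ) (M : Type*) [TopologicalSpace M]
    [ChartedSpace (EuclideanSpace ℝ (Fin m)) M] [IsManifold (𝓡 m) ∞ M] : Type _ :=
  CovariantDerivative (𝓡 m) (EuclideanSpace ℝ (Fin m)) (fun x : M => TangentSpace (𝓡 m) x)

/-- `D` is the Levi-Civita connection of `g`: metric and torsion free. Here `D Y x (X x)` is
the value of `∇_X Y` at `x`. -/
structure IsLeviCivita (g : Metric m M) (D : Connection m M) : Prop where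
  metric : ∀ (X Y Z : VField m M) (x : M), DiffAt X x → DiffAt Y x → DiffAt Z x →
    mvfderiv (𝓡 m) (fun y => g.inner y (Y y) (Z y)) x (X x) =
      g.inner x (D Y x (X x)) (Z x) + g.inner x (Y x) (D Z x (X x))
  torsion : ∀ (X Y : VField m M) (x : M), DiffAt X x → DiffAt Y x →
    D Y x (X x) - D X x (Y x) = mlieBracket (𝓡 m) X Y x

/-- The tangent bundle as a distribution; only used to construct the Levi-Civita connection. -/
def fullDistribution (m : ℕ) (M : Type*) [TopologicalSpace M]
    [ChartedSpace (EuclideanSpace ℝ (Fin m)) M] [IsManifold (𝓡 m) ∞ M] : Distribution m m M where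
  space _ := ⊤
  exists_frame p := by
    let φ := trivializationAt (EuclideanSpace ℝ (Fin m)) (TangentSpace (𝓡 m) : M → Type _) p
    have h := φ.isLocalFrameOn_localFrame_baseSet (𝓡 m) ∞
      (EuclideanSpace.basisFun (Fin m) ℝ).toBasis
    exact ⟨φ.baseSet, φ.open_baseSet, FiberBundle.mem_baseSet_trivializationAt' p, _,
      ⟨h.contMDiffOn, fun x hx => h.linearIndependent hx, fun x hx => top_le_iff.1 (h.generating hx)⟩⟩

/-- The zero complement of the tangent bundle. -/
def zeroComplement (m : ℕ) (M : Type*) [TopologicalSpace M]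
    [ChartedSpace (EuclideanSpace ℝ (Fin m)) M] [IsManifold (𝓡 m) ∞ M] :
    Complement (fullDistribution m M) 0 where
  space _ := ⊥
  exists_frame p := ⟨Set.univ, isOpen_univ, Set.mem_univ p, Fin.elim0,
    ⟨fun i => i.elim0, fun x _ => linearIndependent_empty_type, fun x _ => by simp⟩⟩
  isCompl _ := isCompl_top_bot

/-- A Riemannian metric as a sub-Riemannian structure on the whole tangent bundle. -/
def fullStructure (g : Metric m M) : SubRiemannianStructure m m M where
  toDistribution := fullDistribution m M
  metric x := ((g.inner x).toBilinForm).restrict ⊤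
  symm x v w := g.symm x v w
  pos x v hv := g.pos x v (by simpa using hv)
  smooth U hU X Y hX hY := fun x hx => by
    have := ContMDiffWithinAt.clm_bundle_apply₂ (F₁ := EuclideanSpace ℝ (Fin m))
      (F₂ := EuclideanSpace ℝ (Fin m)) (F₃ := ℝ) (E₃ := Bundle.Trivial M ℝ)
      (g.contMDiff.contMDiffAt.contMDiffWithinAt (s := U) (x := x)) (hX x hx) (hY x hx)
    rw [contMDiffWithinAt_totalSpace] at this
    exact this.2


theorem exists_isLeviCivita (g : Metric m M) : ∃ D, IsLeviCivita g D := by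
  obtain ⟨D, hD⟩ := exists_isHorizontalConnection (fullStructure g) (zeroComplement m M)
  let ι : VField m M → (fullStructure g).Sec := fun Y x => ⟨Y x, trivial⟩
  have fd : ∀ x : M, FiniteDimensional ℝ (TangentSpace (𝓡 m) x) := fun x =>
    inferInstanceAs (FiniteDimensional ℝ (EuclideanSpace ℝ (Fin m)))
  have t2 : ∀ x : M, T2Space (TangentSpace (𝓡 m) x) := fun x =>
    inferInstanceAs (T2Space (EuclideanSpace ℝ (Fin m)))
  let nab : VField m M → (x : M) → (TangentSpace (𝓡 m) x →L[ℝ] TangentSpace (𝓡 m) x) := fun Y x =>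
    LinearMap.toContinuousLinearMap
      (E := TangentSpace (𝓡 m) x) (F' := TangentSpace (𝓡 m) x)
      ((Submodule.subtype _) ∘ₗ (D (ι Y) x) ∘ₗ (Submodule.topEquiv.symm.toLinearMap))
  have hn : ∀ (Y : VField m M) (x : M) (v : TangentSpace (𝓡 m) x),
    nab Y x v = (D (ι Y) x ⟨v, trivial⟩ : TangentSpace (𝓡 m) x) := fun Y x v => rfl
  refine ⟨⟨nab, ⟨?_, ?_⟩⟩, ?_, ?_⟩
  · intro Y Z x hY hZ _
    ext1 v
    have := hD.add (ι Y) (ι Z) x hY hZ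
    exact congrArg Subtype.val (congrArg (fun L => L ⟨v, trivial⟩) this)
  · intro Y f x hY hf _
    ext1 v
    exact congrArg Subtype.val (hD.leibniz f (ι Y) x hf hY ⟨v, trivial⟩)
  · intro X Y Z x hX hY hZ
    exact hD.metric (ι X) (ι Y) (ι Z) x hX hY hZ
  · intro X Y x hX hY
    have h := congrArg Subtype.val (hD.torsion (ι X) (ι Y) x hX hY)
    have h2 := (zeroComplement m M).proj_sec (ι (mlieBracket (𝓡 m) X Y)) x
    exact h.trans (congrArg Subtype.val h2)

/-- The Levi-Civita connection of a Riemannian metric. -/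
def leviCivita (g : Metric m M) : Connection m M := (exists_isLeviCivita g).choose

theorem isLeviCivita_leviCivita (g : Metric m M) : IsLeviCivita g (leviCivita g) :=
  (exists_isLeviCivita g).choose_spec

/-- The Riemannian metric `g` extends `g_c`, and the splitting given by `C` is `g`-orthogonal. -/
structure IsOrthogonalExtension (S : SubRiemannianStructure m k M)
    (C : Complement S.toDistribution l) (g : Metric m M) : Prop where
  extend : ∀ x (v w : S.space x), g.inner x v w = S.metric x v w
  orthogonal : ∀ x (v : S.space x) (w : C.space x), g.inner x v w = 0

/-- For some orthogonal extension `g` of `g_c`, the complement has around every point a smooth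
`g`-orthonormal frame `T_β` such that the horizontal part of `∇_{T_β} T_β` vanishes for every `β`,
where `∇` is the Levi-Civita connection of `g`. -/
def Complement.IsAdapted (C : Complement S.toDistribution l) : Prop :=
  ∃ g : Metric m M, IsOrthogonalExtension S C g ∧
    ∀ p : M, ∃ U : Set M, IsOpen U ∧ p ∈ U ∧ ∃ T : Fin l → VField m M,
      IsFrameOn C.space T U ∧
      (∀ x ∈ U, ∀ a b, g.inner x (T a x) (T b x) = if a = b then 1 else 0) ∧
      ∀ x ∈ U, ∀ b, C.proj x (leviCivita g (T b) x (T b x)) = 0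

/-- `Δ` is a sublaplacian of the sub-Riemannian structure: it is the operator `Δᴴ = divᴴ ∘ ∇ᴴ` for
the splitting given by some adapted complement. -/
def SubRiemannianStructure.IsSublaplacian (S : SubRiemannianStructure m k M)
    (Δ : (M → ℝ) → (M → ℝ)) : Prop :=
  ∃ (l : ℕ) (C : Complement S.toDistribution l), C.IsAdapted ∧
    Δ = C.horizontalLaplacian

end SubRiem

end

/-! This is Bony's strong maximum principle for degenerate operators that are sums of squares plus a
drift. By compactness `u` attains its maximum `c`. The set `F = {u = c}` is closed and nonempty, so
by connectedness it suffices that `F` is open.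

In a smooth orthonormal frame `e i` of the distribution the operator reads `∑ e i (e i u)` plus a
continuous first order term along the `e j` (`Complement.exists_horizontalLaplacian_eq`); in a chart
it becomes a `sumSq`. This operator is elliptic only in horizontal directions, so Hopf's barrier
argument gives less than usual: whenever a C² function `f`, restricted to `F`, has a local maximum
at a point of `F`, its differential there kills each `e i`
(`fderiv_apply_eq_zero_of_sumSq_eq_zero`). Such an `f` plays the role of a normal to `F`, and a
field killed by all of them is called tangent to `F`. The condition involves only the value of the
field at the point, so every horizontal field is tangent.

Tangency passes to Lie brackets. Integral curves of a tangent C¹ field that start in `F` remain in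
`F` for a short time, because the squared distance to `F` satisfies a Gronwall inequality
(`TangentToOn.exists_integralCurve`). Flowing for time `t` along `X`, `Y`, `-X`, `-Y` therefore
leads from `p` to points `p + t² [X, Y](p) + o(t²)` of `F`, and a function maximal on `F` at `p`
cannot increase to second order along them (`TangentToOn.lieBracket`).

Under the Hörmander condition all directions are then tangent, so `F` has no nonzero normals. If a
point near `F` were outside it, its nearest point in `F` would carry the normal joining the two;
hence `F` is open (`mem_nhds_of_forall_fderiv_eq_zero`). -/

section Euclidean

/-! ### Degenerate second order operators: maximum points, barriers and the Hopf lemma. -/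

variable {E : Type*} [NormedAddCommGroup E] [InnerProductSpace ℝ E]

/-- The second derivative is nonpositive at a local maximum. -/
theorem IsLocalMax.fderiv_fderiv_apply_nonpos {w : E → ℝ} {q : E} (h : IsLocalMax w q)
    (hw : ContDiffAt ℝ 2 w q) (v : E) : fderiv ℝ (fderiv ℝ w) q v v ≤ 0 := by
  by_contra! hpos
  have hline : ∀ t : ℝ, HasDerivAt (fun t : ℝ => q + t • v) v t := fun t => by
    simpa using ((hasDerivAt_id t).smul_const v).const_add q
  have h0 : q + (0 : ℝ) • v = q := by simp
  have hcont : Filter.Tendsto (fun t : ℝ => q + t • v) (𝓝 0) (𝓝 q) := by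
    simpa using (hline 0).continuousAt.tendsto
  have hd : ∀ᶠ y in 𝓝 q, DifferentiableAt ℝ w y := by
    filter_upwards [hw.eventually (by simp)] with y hy using hy.differentiableAt two_ne_zero
  have hd' : DifferentiableAt ℝ (fderiv ℝ w) q :=
    (hw.fderiv_right (m := 1) (by norm_num)).differentiableAt one_ne_zero
  have h1 : deriv (fun t : ℝ => w (q + t • v)) =ᶠ[𝓝 0] fun t => fderiv ℝ w (q + t • v) v := by
    filter_upwards [hcont.eventually hd] with t ht
    exact (ht.hasFDerivAt.comp_hasDerivAt t (hline t)).deriv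
  have h2 : HasDerivAt (fun t : ℝ => fderiv ℝ w (q + t • v) v) (fderiv ℝ (fderiv ℝ w) q v v) 0 := by
    have h3 : HasFDerivAt (fderiv ℝ w) (fderiv ℝ (fderiv ℝ w) q) (q + (0 : ℝ) • v) := by
      simpa using hd'.hasFDerivAt
    have h4 : HasDerivAt (fun t : ℝ => fderiv ℝ w (q + t • v)) (fderiv ℝ (fderiv ℝ w) q v) 0 :=
      h3.comp_hasDerivAt 0 (hline 0)
    exact ((ContinuousLinearMap.apply ℝ ℝ v).hasFDerivAt.comp_hasDerivAt 0 h4)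
  have hmax : IsLocalMax (fun t : ℝ => w (q + t • v)) 0 := by
    have := hcont.eventually h
    simpa [IsLocalMax, IsMaxFilter] using this
  have hwc : ContinuousAt (fun t : ℝ => w (q + t • v)) 0 :=
    ContinuousAt.comp (by simpa using hw.continuousAt) (hline 0).continuousAt
  -- A positive second derivative at a critical point makes 0 also a local minimum of the slice, so
  -- the slice is locally constant and its second derivative is 0.
  have hmin : IsLocalMin (fun t : ℝ => w (q + t • v)) 0 := by
    refine isLocalMin_of_deriv_deriv_pos ?_ hmax.deriv_eq_zero hwc
    rw [h1.deriv_eq, h2.deriv]; exact hpos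
  have hconst : (fun t : ℝ => w (q + t • v)) =ᶠ[𝓝 0] fun _ => w (q + (0 : ℝ) • v) := by
    filter_upwards [hmax, hmin] with t h3 h4 using le_antisymm h3 h4
  have h5 := hconst.deriv.deriv_eq
  rw [h1.deriv_eq, h2.deriv] at h5
  simp at h5
  linarith

variable {ι : Type*} [Fintype ι]

/-- The second order operator `∑ i, D²w(Xᵢ, Xᵢ) + Dw(B)`. -/
noncomputable def sumSq (X : ι → E → E) (B : E → E) (w : E → ℝ) (x : E) : ℝ :=
  ∑ i, fderiv ℝ (fderiv ℝ w) x (X i x) (X i x) + fderiv ℝ w x (B x)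

/-- At a local maximum the drift term drops out and every square contributes a nonpositive Hessian
value; the fields need not span, so degenerate operators are allowed. -/
theorem sumSq_nonpos_of_isLocalMax (X : ι → E → E) (B : E → E) {w : E → ℝ} {q : E}
    (h : IsLocalMax w q) (hw : ContDiffAt ℝ 2 w q) : sumSq X B w q ≤ 0 := by
  rw [sumSq, h.fderiv_eq_zero]
  simpa using Finset.sum_nonpos fun i _ => h.fderiv_fderiv_apply_nonpos hw (X i q)

theorem fderiv_fderiv_add {u v : E → ℝ} {x : E} (hu : ContDiffAt ℝ 2 u x)
    (hv : ContDiffAt ℝ 2 v x) :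
    fderiv ℝ (fderiv ℝ (fun y => u y + v y)) x =
      fderiv ℝ (fderiv ℝ u) x + fderiv ℝ (fderiv ℝ v) x := by
  have h1 : fderiv ℝ (fun y => u y + v y) =ᶠ[𝓝 x] fun y => fderiv ℝ u y + fderiv ℝ v y := by
    filter_upwards [hu.eventually (by simp), hv.eventually (by simp)] with y hy hy'
    exact fderiv_fun_add (hy.differentiableAt two_ne_zero) (hy'.differentiableAt two_ne_zero)
  rw [h1.fderiv_eq]
  exact fderiv_fun_add ((hu.fderiv_right (m := 1) (by norm_num)).differentiableAt one_ne_zero)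
    ((hv.fderiv_right (m := 1) (by norm_num)).differentiableAt one_ne_zero)

theorem sumSq_add (X : ι → E → E) (B : E → E) {u v : E → ℝ} {x : E} (hu : ContDiffAt ℝ 2 u x)
    (hv : ContDiffAt ℝ 2 v x) :
    sumSq X B (fun y => u y + v y) x = sumSq X B u x + sumSq X B v x := by
  rw [sumSq, fderiv_fderiv_add hu hv, fderiv_fun_add (hu.differentiableAt two_ne_zero)
    (hv.differentiableAt two_ne_zero)]
  simp [sumSq, Finset.sum_add_distrib]
  ring

/-- The barrier computation. -/
theorem sumSq_exp (X : ι → E → E) (B : E → E) {ψ : E → ℝ} {x : E} (hψ : ContDiffAt ℝ 2 ψ x)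
    (ε α : ℝ) :
    sumSq X B (fun y => ε * (Real.exp (α * ψ y) - 1)) x = ε * α * Real.exp (α * ψ x) *
      (α * ∑ i, (fderiv ℝ ψ x (X i x)) ^ 2 + sumSq X B ψ x) := by
  have h0 : ∀ y, ContDiffAt ℝ 2 ψ y →
      HasFDerivAt (fun y => ε * (Real.exp (α * ψ y) - 1))
        ((ε * α * Real.exp (α * ψ y)) • fderiv ℝ ψ y) y := fun y hy => by
    refine ((((hy.differentiableAt two_ne_zero).hasFDerivAt.const_mul α).exp.sub_const
      1).const_mul ε).congr_fderiv ?_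
    simp only [smul_smul]; congr 1; ring
  have h1 : fderiv ℝ (fun y => ε * (Real.exp (α * ψ y) - 1)) =ᶠ[𝓝 x]
      fun y => (ε * α * Real.exp (α * ψ y)) • fderiv ℝ ψ y := by
    filter_upwards [hψ.eventually (by simp)] with y hy using (h0 y hy).fderiv
  have h2 : HasFDerivAt (fun y => ε * α * Real.exp (α * ψ y))
      ((ε * α * α * Real.exp (α * ψ x)) • fderiv ℝ ψ x) x := by
    refine ((((hψ.differentiableAt two_ne_zero).hasFDerivAt.const_mul α).exp).const_mul
      (ε * α)).congr_fderiv ?_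
    simp only [smul_smul]; congr 1; ring
  have h3 := h2.smul ((hψ.fderiv_right (m := 1) (by norm_num)).differentiableAt
    one_ne_zero).hasFDerivAt
  rw [sumSq, h1.fderiv_eq, h1.self_of_nhds,
    show fderiv ℝ (fun y => (ε * α * Real.exp (α * ψ y)) • fderiv ℝ ψ y) x = _ from h3.fderiv]
  simp [sumSq, mul_add, Finset.mul_sum, Finset.sum_add_distrib]
  have : ∀ i, ε * α * α * Real.exp (α * ψ x) * (fderiv ℝ ψ x) (X i x) * (fderiv ℝ ψ x) (X i x) =
    ε * α * Real.exp (α * ψ x) * (α * (fderiv ℝ ψ x) (X i x) ^ 2) := fun i => by ring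
  simp only [this]
  ring

/-- Turns strict positivity of the operator on the barrier at one point into positivity on a small
ball. -/
theorem ContinuousAt.sumSq {X : ι → E → E} {B : E → E} {w : E → ℝ} {x : E}
    (hX : ∀ i, ContinuousAt (X i) x) (hB : ContinuousAt B x) (hw : ContDiffAt ℝ 2 w x) :
    ContinuousAt (sumSq X B w) x := by
  have h1 : ContDiffAt ℝ 1 (fderiv ℝ w) x := hw.fderiv_right (by norm_num)
  have h2 : ContDiffAt ℝ 0 (fderiv ℝ (fderiv ℝ w)) x := h1.fderiv_right (by norm_num)
  unfold _root_.sumSq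
  exact (tendsto_finsetSum _ fun i _ =>
    (h2.continuousAt.clm_apply (hX i)).clm_apply (hX i)).add (h1.continuousAt.clm_apply hB)

/-- Bony's form of the Hopf lemma: at a point of the maximum set of a solution, the vector fields
are tangent to the maximum set. -/
theorem fderiv_apply_eq_zero_of_sumSq_eq_zero [FiniteDimensional ℝ E] {V : Set E} (hV : IsOpen V)
    {X : ι → E → E} {B : E → E} (hX : ∀ i, ContinuousOn (X i) V) (hB : ContinuousOn B V)
    {u : E → ℝ} (hu : ContDiffOn ℝ 2 u V) (hL : ∀ x ∈ V, sumSq X B u x = 0) {c : ℝ}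
    (hc : ∀ x ∈ V, u x ≤ c) {p : E} (hp : p ∈ V) (hpc : u p = c) {f : E → ℝ}
    (hf : ContDiffAt ℝ 2 f p) (hfu : ∀ᶠ y in 𝓝 p, u y = c → f y ≤ f p) (i : ι) :
    fderiv ℝ f p (X i p) = 0 := by
  by_contra hne
  -- Subtracting the squared distance keeps the differential at `p` but makes the maximum on the
  -- contact set strict: there `ψ y ≤ -‖y - p‖ ^ 2`.
  set ψ : E → ℝ := fun y => f y - f p - ‖y - p‖ ^ 2 with hψdef
  have hψ : ContDiffAt ℝ 2 ψ p :=
    (hf.sub contDiffAt_const).sub ((contDiffAt_id.sub contDiffAt_const).norm_sq ℝ)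
  have hdψ : fderiv ℝ ψ p = fderiv ℝ f p := by
    have h1 : HasFDerivAt (fun y : E => ‖y - p‖ ^ 2) (0 : E →L[ℝ] ℝ) p := by
      refine ((hasFDerivAt_id p).sub_const p).norm_sq.congr_fderiv ?_
      ext v; simp
    have := (((hf.differentiableAt two_ne_zero).hasFDerivAt.sub_const (f p)).sub h1).fderiv
    exact this.trans (by simp)
  set A : E → ℝ := fun x => ∑ i, (fderiv ℝ ψ x (X i x)) ^ 2 with hA
  have hXp : ∀ i, ContinuousAt (X i) p := fun i => (hX i).continuousAt (hV.mem_nhds hp)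
  have hAc : ContinuousAt A p := by
    have h1 : ContDiffAt ℝ 1 (fderiv ℝ ψ) p := hψ.fderiv_right (by norm_num)
    exact tendsto_finsetSum _ fun i _ => (h1.continuousAt.clm_apply (hXp i)).pow 2
  have hApos : 0 < A p := by
    refine Finset.sum_pos' (fun i _ => sq_nonneg _) ⟨i, Finset.mem_univ _, ?_⟩
    rw [hdψ]; positivity
  -- By `sumSq_exp` this quantity is the sign of the operator on `exp (α ψ)`. Since `A p > 0`, a
  -- large `α` dominates the uncontrolled term.
  obtain ⟨α, hα0, hα⟩ : ∃ α : ℝ, 0 < α ∧ 0 < α * A p + sumSq X B ψ p := by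
    refine ⟨(|sumSq X B ψ p| + 1) / A p, by positivity, ?_⟩
    rw [div_mul_cancel₀ _ hApos.ne']
    linarith [neg_abs_le (sumSq X B ψ p)]
  have hQ : ContinuousAt (fun x => α * A x + sumSq X B ψ x) p :=
    (hAc.const_mul α).add
      (ContinuousAt.sumSq hXp (hB.continuousAt (hV.mem_nhds hp)) hψ)
  obtain ⟨r, hr, hball⟩ := Metric.nhds_basis_closedBall.mem_iff.1
    (((hV.eventually_mem hp).and (hQ.eventually (lt_mem_nhds hα))).and
      ((hψ.eventually (by simp)).and hfu))
  have hballV : ∀ x ∈ Metric.closedBall p r, x ∈ V := fun x hx => (hball hx).1.1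
  have hballQ : ∀ x ∈ Metric.closedBall p r, 0 < α * A x + sumSq X B ψ x :=
    fun x hx => (hball hx).1.2
  have hballψ : ∀ x ∈ Metric.closedBall p r, ContDiffAt ℝ 2 ψ x := fun x hx => (hball hx).2.1
  have hballf : ∀ x ∈ Metric.closedBall p r, u x = c → f x ≤ f p := fun x hx => (hball hx).2.2
  have hψc : ContinuousOn ψ (Metric.closedBall p r) := fun x hx =>
    (hballψ x hx).continuousAt.continuousWithinAt
  have huc : ContinuousOn u (Metric.closedBall p r) := hu.continuousOn.mono hballV
  have hsub : Metric.sphere p r ⊆ Metric.closedBall p r := Metric.sphere_subset_closedBall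
  have hψp : ψ p = 0 := by simp [hψdef]
  -- On the sphere, points with `u = c` have `ψ < 0`; on the compact part where `ψ ≥ 0` the function
  -- `u` therefore stays below `c` by a definite amount.
  obtain ⟨δ, hδ, hδu⟩ : ∃ δ > 0, ∀ x ∈ Metric.sphere p r, 0 ≤ ψ x → u x ≤ c - δ := by
    set K := Metric.sphere p r ∩ ψ ⁻¹' Set.Ici 0
    have hK : IsCompact K := (isCompact_sphere p r).of_isClosed_subset
      ((hψc.mono hsub).preimage_isClosed_of_isClosed Metric.isClosed_sphere isClosed_Ici)
      Set.inter_subset_left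
    rcases K.eq_empty_or_nonempty with hK0 | hK0
    · refine ⟨1, one_pos, fun x hx hx' => ?_⟩
      have : x ∈ K := ⟨hx, hx'⟩
      rw [hK0] at this; exact this.elim
    · obtain ⟨y, hy, hymax⟩ := hK.exists_isMaxOn hK0
        (huc.mono (Set.inter_subset_left.trans hsub))
      refine ⟨c - u y, ?_, fun x hx hx' => ?_⟩
      · refine sub_pos.2 (lt_of_le_of_ne (hc y (hballV y (hsub hy.1))) fun h => ?_)
        have h1 := hballf y (hsub hy.1) h
        have h2 : 0 ≤ f y - f p - ‖y - p‖ ^ 2 := hy.2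
        have h3 : ‖y - p‖ = r := by simpa [dist_eq_norm] using hy.1
        rw [h3] at h2
        nlinarith
      · have : u x ≤ u y := hymax ⟨hx, hx'⟩
        linarith
  have hexpc : ContinuousOn (fun y => Real.exp (α * ψ y)) (Metric.closedBall p r) :=
    (hψc.const_smul α).rexp
  obtain ⟨K, hK⟩ := ((isCompact_closedBall p r).bddAbove_image hexpc)
  have hK : ∀ x ∈ Metric.closedBall p r, Real.exp (α * ψ x) ≤ K := fun x hx =>
    hK ⟨x, hx, rfl⟩
  have hK0 : 0 < K := (Real.exp_pos _).trans_le (hK p (Metric.mem_closedBall_self hr.le))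
  -- With this `ε` the barrier term is smaller than the gap `δ` where `ψ ≥ 0` on the sphere, and it
  -- is negative where `ψ < 0`. So `w < c` on the whole sphere, while `w p = c`.
  set ε := δ / K with hε
  have hε0 : 0 < ε := by positivity
  set w : E → ℝ := fun y => u y + ε * (Real.exp (α * ψ y) - 1) with hw
  have hwp : w p = c := by simp [hw, hψp, hpc]
  have hws : ∀ x ∈ Metric.sphere p r, w x < c := fun x hx => by
    rcases le_or_gt 0 (ψ x) with h | h
    · have h1 := hδu x hx h
      have h2 : ε * Real.exp (α * ψ x) ≤ δ := by
        calc ε * Real.exp (α * ψ x) ≤ ε * K := by gcongr; exact hK x (hsub hx)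
          _ = δ := by rw [hε]; field_simp
      simp only [hw]; linarith
    · have h1 := hc x (hballV x (hsub hx))
      have h2 : Real.exp (α * ψ x) < 1 := by
        rw [Real.exp_lt_one_iff]; exact mul_neg_of_pos_of_neg hα0 h
      simp only [hw]; nlinarith
  have hwc : ContinuousOn w (Metric.closedBall p r) :=
    huc.add (continuousOn_const.mul (hexpc.sub continuousOn_const))
  obtain ⟨q, hq, hqmax⟩ := (isCompact_closedBall p r).exists_isMaxOn
    ⟨p, Metric.mem_closedBall_self hr.le⟩ hwc
  have hqc : c ≤ w q := hwp ▸ hqmax (Metric.mem_closedBall_self hr.le)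
  have hqb : q ∈ Metric.ball p r := by
    rw [Metric.mem_ball]
    refine lt_of_le_of_ne hq fun h => ?_
    linarith [hws q h]
  -- The maximum of `w` is interior, so the operator is nonpositive on `w` at `q`; but it is 0 on
  -- `u` and positive on the barrier.
  have hlm : IsLocalMax w q := hqmax.isLocalMax
    (Filter.mem_of_superset (Metric.isOpen_ball.mem_nhds hqb) Metric.ball_subset_closedBall)
  have huq : ContDiffAt ℝ 2 u q := hu.contDiffAt (hV.mem_nhds (hballV q hq))
  have hvq : ContDiffAt ℝ 2 (fun y => ε * (Real.exp (α * ψ y) - 1)) q :=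
    contDiffAt_const.mul (((contDiffAt_const.mul (hballψ q hq)).exp).sub contDiffAt_const)
  have h1 := sumSq_nonpos_of_isLocalMax X B hlm (huq.add hvq)
  rw [hw, sumSq_add X B huq hvq, hL q (hballV q hq), sumSq_exp X B (hballψ q hq)] at h1
  have h2 : 0 < ε * α * Real.exp (α * ψ q) *
      (α * ∑ i, (fderiv ℝ ψ q (X i q)) ^ 2 + sumSq X B ψ q) := by
    have := hballQ q hq
    simp only [hA] at this
    positivity
  linarith

/-! ### Vector fields tangent to a closed set, and flow invariance. -/

/-- The vector field `X` is tangent to the set `F` at the points of `V`: it is annihilated by the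
differential of any `C²` function whose restriction to `F` has a local maximum at the point. -/
def TangentToOn (X : E → E) (F V : Set E) : Prop :=
  ∀ p ∈ V, p ∈ F → ∀ f : E → ℝ, ContDiffAt ℝ 2 f p → (∀ᶠ y in 𝓝 p, y ∈ F → f y ≤ f p) →
    fderiv ℝ f p (X p) = 0

theorem TangentToOn.neg {X : E → E} {F V : Set E} (h : TangentToOn X F V) :
    TangentToOn (fun x => -X x) F V := fun p hp hpF f hf hfF => by
  rw [map_neg, h p hp hpF f hf hfF, neg_zero]

/-- The test function is `x ↦ -‖z - x‖ ^ 2`, maximal on `F` at a nearest point `y` of `z`, with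
differential `2 ⟨z - y, ·⟩` there. Thus `z - y` is a normal to `F` in the metric sense. -/
theorem TangentToOn.inner_eq_zero {X : E → E} {F V : Set E} (h : TangentToOn X F V) {y z : E}
    (hy : y ∈ V) (hyF : y ∈ F) (hmin : ∀ᶠ x in 𝓝 y, x ∈ F → ‖z - y‖ ≤ ‖z - x‖) :
    inner ℝ (z - y) (X y) = 0 := by
  have h1 : HasFDerivAt (fun x : E => -‖z - x‖ ^ 2) (2 • innerSL ℝ (z - y)) y := by
    refine (((hasFDerivAt_id y).const_sub z).norm_sq.neg).congr_fderiv ?_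
    ext v; simp; ring
  have h2 := h y hy hyF _ ((contDiffAt_const.sub contDiffAt_id).norm_sq ℝ).neg (by
    filter_upwards [hmin] with x hx hxF
    exact neg_le_neg (pow_le_pow_left₀ (norm_nonneg _) (hx hxF) 2))
  have h3 : fderiv ℝ (fun x : E => -‖z - x‖ ^ 2) y (X y) = 0 := h2
  rw [h1.fderiv] at h3
  simpa [inner_sub_left] using h3

/-- Flow invariance (Bony, Brezis): integral curves of a tangent vector field which start in a
closed set stay there. -/
theorem TangentToOn.exists_integralCurve [FiniteDimensional ℝ E] {X : E → E} {F V : Set E}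
    (hV : IsOpen V) (hF : ∀ x ∈ V, x ∈ closure F → x ∈ F) (hX : ContDiffOn ℝ 1 X V)
    (hXF : TangentToOn X F V) {p : E} (hp : p ∈ V) {ρ : ℝ} (hρ : 0 < ρ) :
    ∃ r > 0, ∃ ε > 0, ∀ a ∈ F, a ∈ Metric.closedBall p r → ∃ γ : ℝ → E, γ 0 = a ∧
      ∀ t ∈ Set.Icc 0 ε, HasDerivAt γ (X (γ t)) t ∧ γ t ∈ F ∧ γ t ∈ Metric.ball p ρ := by
  have hXp : ContDiffAt ℝ 1 X p := hX.contDiffAt (hV.mem_nhds hp)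
  obtain ⟨L, s, hs, hL⟩ := hXp.exists_lipschitzOnWith
  obtain ⟨R, hR, hball⟩ := Metric.nhds_basis_closedBall.mem_iff.1
    (Filter.inter_mem (hV.mem_nhds hp) hs)
  -- The curve and its starting point lie in the `ρ₀`-ball, so a nearest point to the curve is less
  -- than `2 ρ₀` from it and less than `3 ρ₀ ≤ R` from `p`, where `X` is Lipschitz.
  set ρ₀ := min ρ (R / 3) with hρ₀
  have hρ₀0 : 0 < ρ₀ := by positivity
  have hρR : 3 * ρ₀ ≤ R := by
    have := min_le_right ρ (R / 3); linarith
  obtain ⟨ε', hε', a', r', L', K', hr', hpl⟩ := IsPicardLindelof.of_contDiffAt_one hXp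
  obtain ⟨α, hα, hαc⟩ := (hpl 0).exists_forall_mem_closedBall_eq_hasDerivWithinAt_continuousOn
  simp only [zero_sub, zero_add] at hα hαc
  have hα0 : α (p, 0) = p := (hα p (Metric.mem_closedBall_self r'.2)).1
  have hcont : ContinuousAt α (p, 0) := hαc.continuousAt
    (prod_mem_nhds (Metric.closedBall_mem_nhds p hr') (Icc_mem_nhds (by simpa) hε'))
  -- Joint continuity in initial point and time gives one radius and one existence time for all
  -- nearby starting points; later the starting point moves with the flow time.
  have hev : ∀ᶠ z in 𝓝 p ×ˢ 𝓝 (0 : ℝ), α z ∈ Metric.ball p ρ₀ := by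
    rw [← nhds_prod_eq]
    exact hcont (by rw [hα0]; exact Metric.ball_mem_nhds p hρ₀0)
  obtain ⟨⟨r₁, ε₁⟩, ⟨hr₁, hε₁⟩, hsub⟩ := ((Metric.nhds_basis_closedBall (x := p)).prod
    (Metric.nhds_basis_closedBall (x := (0 : ℝ)))).mem_iff.1 hev
  simp only at hr₁ hε₁ hsub
  have hr'0 : (0 : ℝ) < r' := hr'
  set r := min (min r₁ r') ρ₀ with hr
  set ε := min ε₁ (ε' / 2) with hε
  have hr0 : 0 < r := by positivity
  have hε0 : 0 < ε := by positivity
  refine ⟨r, hr0, ε, hε0, fun a haF ha => ?_⟩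
  have hrr₁ : r ≤ r₁ := (min_le_left _ _).trans (min_le_left _ _)
  have hrr' : r ≤ r' := (min_le_left _ _).trans (min_le_right _ _)
  have har₁ := Metric.closedBall_subset_closedBall hrr₁ ha
  obtain ⟨hγ0, hγ⟩ := hα a (Metric.closedBall_subset_closedBall hrr' ha)
  set γ : ℝ → E := fun t => α (a, t) with hγdef
  have hεε' : ε < ε' := by have := min_le_right ε₁ (ε' / 2); linarith
  have hγd : ∀ t ∈ Set.Icc 0 ε, HasDerivAt γ (X (γ t)) t := fun t ht =>
    (hγ t ⟨by linarith [ht.1], by linarith [ht.2]⟩).hasDerivAt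
      (Icc_mem_nhds (by linarith [ht.1]) (by linarith [ht.2]))
  have hγb : ∀ t ∈ Set.Icc 0 ε, γ t ∈ Metric.ball p ρ₀ := fun t ht => by
    refine hsub ⟨har₁, ?_⟩
    rw [Metric.mem_closedBall, Real.dist_eq, sub_zero, abs_of_nonneg ht.1]
    exact ht.2.trans (min_le_left _ _)
  have hγc : ContinuousOn γ (Set.Icc 0 ε) := fun t ht => (hγd t ht).continuousAt.continuousWithinAt
  -- `F` is closed only relative to `V`; cutting with a closed ball gives a closed set, in which
  -- nearest points exist.
  set G := F ∩ Metric.closedBall p (3 * ρ₀) with hG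
  have hGV : ∀ x ∈ Metric.closedBall p (3 * ρ₀), x ∈ V ∩ s := fun x hx =>
    hball (Metric.closedBall_subset_closedBall hρR hx)
  have hGc : IsClosed G := by
    refine isClosed_of_closure_subset fun x hx => ?_
    have hxb : x ∈ Metric.closedBall p (3 * ρ₀) :=
      closure_minimal Set.inter_subset_right Metric.isClosed_closedBall hx
    exact ⟨hF x (hGV x hxb).1 (closure_mono Set.inter_subset_left hx), hxb⟩
  have hab : a ∈ Metric.ball p ρ₀ := hγ0 ▸ hγb 0 ⟨le_rfl, hε0.le⟩
  have haG : a ∈ G := ⟨haF, Metric.mem_closedBall.2 (by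
    have := Metric.mem_ball.1 hab; linarith)⟩
  have hnear : ∀ t ∈ Set.Icc 0 ε, ∃ y ∈ G, Metric.infDist (γ t) G = dist (γ t) y ∧
      inner ℝ (γ t - y) (X y) = 0 := fun t ht => by
    obtain ⟨y, hy, hdist⟩ := hGc.exists_infDist_eq_dist ⟨a, haG⟩ (γ t)
    refine ⟨y, hy, hdist, hXF.inner_eq_zero (hGV y hy.2).1 hy.1 ?_⟩
    have h1 : dist (γ t) y ≤ dist (γ t) a := hdist ▸ Metric.infDist_le_dist_of_mem haG
    have hyb : y ∈ Metric.ball p (3 * ρ₀) := by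
      have h2 := Metric.mem_ball.1 (hγb t ht)
      have h3 := Metric.mem_ball.1 hab
      have h4 := dist_triangle_left y p (γ t)
      have h5 := dist_triangle_right (γ t) a p
      rw [Metric.mem_ball]
      linarith
    filter_upwards [Metric.isOpen_ball.mem_nhds hyb] with x hx hxF
    rw [← dist_eq_norm, ← dist_eq_norm, ← hdist]
    exact Metric.infDist_le_dist_of_mem ⟨hxF, Metric.ball_subset_closedBall hx⟩
  -- At time `t` fix a nearest point `y`. Then `‖γ z - y‖ ^ 2` bounds the squared distance from
  -- above for `z > t`, with equality at `t`. Its derivative `2 ⟨γ - y, X γ⟩` equals `2 ⟨γ - y, X γ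
  -- - X y⟩` by tangency, which is at most `2 L` times the squared distance. As the initial value is
  -- 0, Gronwall gives 0 throughout.
  have hgron := le_gronwallBound_of_liminf_deriv_right_le
    (f := fun t => Metric.infDist (γ t) G ^ 2) (f' := fun t => 2 * L * Metric.infDist (γ t) G ^ 2)
    (δ := 0) (K := 2 * L) (ε := 0) (a := 0) (b := ε)
    (((Metric.continuous_infDist_pt G).comp_continuousOn hγc).pow 2) (by
      intro t ht b hb
      have ht' : t ∈ Set.Icc 0 ε := ⟨ht.1, ht.2.le⟩
      obtain ⟨y, hy, hdist, hinner⟩ := hnear t ht'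
      have hg : HasDerivAt (fun z => ‖γ z - y‖ ^ 2) (2 * inner ℝ (γ t - y) (X (γ t))) t :=
        ((hγd t ht').sub_const y).norm_sq
      have hle : 2 * inner ℝ (γ t - y) (X (γ t)) ≤ 2 * L * Metric.infDist (γ t) G ^ 2 := by
        have h1 : inner ℝ (γ t - y) (X (γ t)) = inner ℝ (γ t - y) (X (γ t) - X y) := by
          rw [inner_sub_right, hinner, sub_zero]
        have h2 : ‖X (γ t) - X y‖ ≤ L * ‖γ t - y‖ := by
          have := hL.dist_le_mul (γ t) (hGV _ (Metric.ball_subset_closedBall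
            (Metric.ball_subset_ball (by linarith) (hγb t ht')))).2 y (hGV y hy.2).2
          simpa [dist_eq_norm] using this
        have h3 := real_inner_le_norm (γ t - y) (X (γ t) - X y)
        rw [h1, hdist, dist_eq_norm]
        nlinarith [norm_nonneg (γ t - y)]
      have hslope := (hasDerivAt_iff_tendsto_slope.1 hg).mono_left
        (nhdsWithin_mono t (fun z (hz : t < z) => hz.ne'))
      have := hslope.eventually (gt_mem_nhds (hle.trans_lt hb))
      refine Filter.Eventually.frequently ?_
      filter_upwards [this, self_mem_nhdsWithin] with z hz (htz : t < z)
      refine lt_of_le_of_lt ?_ hz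
      rw [slope_def_field, div_eq_inv_mul]
      refine mul_le_mul_of_nonneg_left ?_ (inv_nonneg.2 (sub_pos.2 htz).le)
      rw [hdist, ← dist_eq_norm, ← dist_eq_norm]
      have : Metric.infDist (γ z) G ≤ dist (γ z) y := Metric.infDist_le_dist_of_mem hy
      have := pow_le_pow_left₀ Metric.infDist_nonneg this 2
      linarith) (by
      rw [show γ 0 = a from hγ0, Metric.infDist_zero_of_mem haG]; norm_num) (by intro t _; simp)
  refine ⟨γ, hγ0, fun t ht => ⟨hγd t ht, ?_, Metric.ball_subset_ball (min_le_left _ _) (hγb t ht)⟩⟩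
  have h1 := hgron t ht
  rw [gronwallBound_ε0_δ0] at h1
  have h2 : Metric.infDist (γ t) G = 0 := by
    have := sq_nonneg (Metric.infDist (γ t) G)
    exact pow_eq_zero_iff two_ne_zero |>.1 (le_antisymm h1 this)
  exact ((hGc.mem_iff_infDist_zero ⟨a, haG⟩).2 h2).1

/-! ### Second order expansions of flows and the tangency of Lie brackets. -/

/-- The curve `a` has the expansion `p + t v + t² w + o(t²)` as `t` tends to zero from above. -/
def HasExpansion (p : E) (a : ℝ → E) (v w : E) : Prop :=
  (fun t => a t - p - t • v - t ^ 2 • w) =o[𝓝[>] 0] fun t : ℝ => t ^ 2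

theorem HasExpansion.sub_isBigO {p : E} {a : ℝ → E} {v w : E} (h : HasExpansion p a v w) :
    (fun t => a t - p - t • v) =O[𝓝[>] 0] fun t : ℝ => t ^ 2 := by
  have h1 : (fun t : ℝ => t ^ 2 • w) =O[𝓝[>] 0] fun t : ℝ => t ^ 2 :=
    Asymptotics.IsBigO.of_bound ‖w‖ (Filter.Eventually.of_forall fun t => by
      rw [norm_smul, mul_comm])
  exact (h.isBigO.add h1).congr_left fun t => by abel

theorem sq_isBigO_self_nhdsGT : (fun t : ℝ => t ^ 2) =O[𝓝[>] 0] fun t : ℝ => t := by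
  refine Asymptotics.IsBigO.of_bound 1 ?_
  filter_upwards [Ioo_mem_nhdsGT one_pos] with t ht
  rw [norm_pow, one_mul, pow_two]
  refine mul_le_of_le_one_left (norm_nonneg _) ?_
  rw [Real.norm_eq_abs, abs_of_pos ht.1]; exact ht.2.le

theorem HasExpansion.sub_isBigO_id {p : E} {a : ℝ → E} {v w : E} (h : HasExpansion p a v w) :
    (fun t => a t - p) =O[𝓝[>] 0] fun t : ℝ => t := by
  have h1 : (fun t : ℝ => t • v) =O[𝓝[>] 0] fun t : ℝ => t :=
    Asymptotics.IsBigO.of_bound ‖v‖ (Filter.Eventually.of_forall fun t => by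
      rw [norm_smul, mul_comm])
  exact ((h.sub_isBigO.trans sq_isBigO_self_nhdsGT).add h1).congr_left fun t => by abel

theorem HasExpansion.tendsto {p : E} {a : ℝ → E} {v w : E} (h : HasExpansion p a v w) :
    Filter.Tendsto a (𝓝[>] 0) (𝓝 p) := by
  have h1 := h.sub_isBigO_id.trans_tendsto (Filter.tendsto_id.mono_left nhdsWithin_le_nhds)
  simpa using h1.add_const p

/-- The second order expansion of the flow of a vector field along a curve of initial points. -/
theorem HasExpansion.integralCurve {p : E} {a : ℝ → E} {v w : E} (h : HasExpansion p a v w)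
    {X : E → E} (hX : DifferentiableAt ℝ X p) {γ : ℝ → ℝ → E} {K : ℝ}
    (hγ : ∀ᶠ t in 𝓝[>] (0 : ℝ), γ t 0 = a t ∧ ∀ s ∈ Set.Icc 0 t,
      HasDerivAt (γ t) (X (γ t s)) s ∧ ‖X (γ t s)‖ ≤ K) :
    HasExpansion p (fun t => γ t t) (v + X p)
      (w + (fderiv ℝ X p v + (2⁻¹ : ℝ) • fderiv ℝ X p (X p))) := by
  set A := fderiv ℝ X p with hA
  obtain ⟨C₁, hC₁0, hC₁⟩ := h.sub_isBigO_id.exists_nonneg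
  obtain ⟨C₂, hC₂0, hC₂⟩ := h.sub_isBigO.exists_nonneg
  have hK : 0 ≤ K := by
    obtain ⟨t, ht, htpos⟩ := (hγ.and self_mem_nhdsWithin).exists
    exact (norm_nonneg _).trans (ht.2 0 ⟨le_rfl, le_of_lt htpos⟩).2
  refine Asymptotics.isLittleO_iff.2 fun c hc => ?_
  -- The final error is `η (C₁ + K + 2) t²`: `C₁ + K` from linearizing `X`, one from the first order
  -- error multiplied by `‖A‖`, and one from the expansion of `a`.
  set η := c / (C₁ + K + 2) with hη
  have hη0 : 0 < η := by positivity
  set C₃ := (‖A‖ + η) * (C₁ + K) with hC₃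
  obtain ⟨ρ, hρ, hXρ⟩ := Metric.eventually_nhds_iff_ball.1
    (Asymptotics.isLittleO_iff.1 hX.hasFDerivAt.isLittleO hη0)
  have hsmall : ∀ D : ℝ, 0 ≤ D → ∀ e : ℝ, 0 < e → ∀ᶠ t in 𝓝[>] (0 : ℝ), D * t < e :=
    fun D hD e he => by
    have : Filter.Tendsto (fun t : ℝ => D * t) (𝓝[>] 0) (𝓝 0) := by
      have := (continuous_const_mul D).tendsto (0 : ℝ)
      rw [mul_zero] at this
      exact this.mono_left nhdsWithin_le_nhds
    exact this.eventually (gt_mem_nhds he)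
  filter_upwards [hγ, hC₁.bound, hC₂.bound, Asymptotics.isLittleO_iff.1 h hη0,
    hsmall (C₁ + K) (by positivity) ρ hρ, hsmall (‖A‖ * (C₂ + C₃)) (by positivity) η hη0,
    self_mem_nhdsWithin] with t ⟨h0, ht⟩ h1 h2 h3 h4 h5 (htpos : 0 < t)
  simp only [norm_pow, Real.norm_eq_abs, abs_of_pos htpos] at h1 h2 h3 ⊢
  -- Bootstrap: a bound on `X` gives `γ - p` to order `t`, this gives the first order expansion with
  -- error `t²`, and inserting that into the linearization of `X` gives the second order. Each gain
  -- is a mean value inequality in `s` with `t` fixed.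
  have hdist : ∀ s ∈ Set.Icc 0 t, ‖γ t s - p‖ ≤ (C₁ + K) * t := fun s hs => by
    have := norm_image_sub_le_of_norm_deriv_le_segment' (fun x hx => (ht x hx).1.hasDerivWithinAt)
      (fun x hx => (ht x ⟨hx.1, hx.2.le⟩).2) s hs
    rw [h0, sub_zero] at this
    calc ‖γ t s - p‖ = ‖(γ t s - a t) + (a t - p)‖ := by congr 1; abel
      _ ≤ K * s + C₁ * t := (norm_add_le _ _).trans (add_le_add this h1)
      _ ≤ K * t + C₁ * t := by gcongr; exact hs.2
      _ = _ := by ring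
  have hXs : ∀ s ∈ Set.Icc 0 t, ‖X (γ t s) - X p - A (γ t s - p)‖ ≤ η * ((C₁ + K) * t) :=
    fun s hs => by
    refine (hXρ (γ t s) ?_).trans (by gcongr; exact hdist s hs)
    rw [Metric.mem_ball, dist_eq_norm]
    exact (hdist s hs).trans_lt h4
  have hX0 : ∀ s ∈ Set.Icc 0 t, ‖X (γ t s) - X p‖ ≤ C₃ * t := fun s hs => by
    calc ‖X (γ t s) - X p‖ = ‖(X (γ t s) - X p - A (γ t s - p)) + A (γ t s - p)‖ := by
          congr 1; abel
      _ ≤ η * ((C₁ + K) * t) + ‖A‖ * ((C₁ + K) * t) := (norm_add_le _ _).trans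
          (add_le_add (hXs s hs) ((A.le_opNorm _).trans (by gcongr; exact hdist s hs)))
      _ = C₃ * t := by rw [hC₃]; ring
  have hfirst : ∀ s ∈ Set.Icc 0 t, ‖γ t s - p - t • v - s • X p‖ ≤ (C₂ + C₃) * t ^ 2 :=
    fun s hs => by
    have := norm_image_sub_le_of_norm_deriv_le_segment' (f := fun s => γ t s - s • X p)
      (f' := fun s => X (γ t s) - X p)
      (fun x hx => ((ht x hx).1.sub (by simpa using (hasDerivAt_id x).smul_const (X p))
        ).hasDerivWithinAt)
      (fun x hx => hX0 x ⟨hx.1, hx.2.le⟩) s hs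
    simp only [h0, sub_zero, zero_smul] at this
    have hC₃0 : 0 ≤ C₃ := by positivity
    calc ‖γ t s - p - t • v - s • X p‖ = ‖(γ t s - s • X p - a t) + (a t - p - t • v)‖ := by
          congr 1; abel
      _ ≤ C₃ * t * s + C₂ * t ^ 2 := (norm_add_le _ _).trans (add_le_add this h2)
      _ ≤ C₃ * t * t + C₂ * t ^ 2 := by gcongr; exact hs.2
      _ = _ := by ring
  -- The subtracted polynomial in `s` is the primitive of `X p + A (t v + s X p)`, the linearized
  -- field along the first order expansion.
  have hsecond := norm_image_sub_le_of_norm_deriv_le_segment'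
    (f := fun s => γ t s - s • X p - s • (t • A v) - s ^ 2 • ((2⁻¹ : ℝ) • A (X p)))
    (f' := fun s => X (γ t s) - X p - t • A v - s • A (X p)) (a := 0) (b := t)
    (C := η * (C₁ + K + 1) * t)
    (fun x hx => by
      have e1 : HasDerivAt (fun s : ℝ => s • X p) (X p) x := by
        simpa using (hasDerivAt_id x).smul_const (X p)
      have e2 : HasDerivAt (fun s : ℝ => s • (t • A v)) (t • A v) x := by
        simpa using (hasDerivAt_id x).smul_const (t • A v)
      have e3 : HasDerivAt (fun s : ℝ => s ^ 2 • ((2⁻¹ : ℝ) • A (X p))) (x • A (X p)) x := by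
        refine ((hasDerivAt_pow 2 x).smul_const ((2⁻¹ : ℝ) • A (X p))).congr_deriv ?_
        rw [smul_smul]; congr 1; norm_num; ring
      exact ((((ht x hx).1.sub e1).sub e2).sub e3).hasDerivWithinAt)
    (fun x hx => by
      have hx' : x ∈ Set.Icc 0 t := ⟨hx.1, hx.2.le⟩
      calc ‖X (γ t x) - X p - t • A v - x • A (X p)‖
          = ‖(X (γ t x) - X p - A (γ t x - p)) + A (γ t x - p - t • v - x • X p)‖ := by
            congr 1; simp only [map_sub, map_smul]; abel
        _ ≤ η * ((C₁ + K) * t) + ‖A‖ * ((C₂ + C₃) * t ^ 2) := (norm_add_le _ _).trans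
          (add_le_add (hXs x hx') ((A.le_opNorm _).trans (by gcongr; exact hfirst x hx')))
        _ = η * ((C₁ + K) * t) + (‖A‖ * (C₂ + C₃) * t) * t := by ring
        _ ≤ η * ((C₁ + K) * t) + η * t := by gcongr
        _ = _ := by ring) t ⟨htpos.le, le_rfl⟩
  simp only [h0, zero_smul, sub_zero, ne_eq, OfNat.ofNat_ne_zero, not_false_eq_true, zero_pow]
    at hsecond
  calc ‖γ t t - p - t • (v + X p) - t ^ 2 • (w + (A v + (2⁻¹ : ℝ) • A (X p)))‖
      = ‖(γ t t - t • X p - t • t • A v - t ^ 2 • (2⁻¹ : ℝ) • A (X p) - a t) +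
          (a t - p - t • v - t ^ 2 • w)‖ := by
        congr 1; rw [smul_smul t t, ← pow_two]; simp only [smul_add]; abel
    _ ≤ η * (C₁ + K + 1) * t * t + η * t ^ 2 := (norm_add_le _ _).trans (add_le_add hsecond h3)
    _ = η * (C₁ + K + 2) * t ^ 2 := by ring
    _ = c * t ^ 2 := by rw [hη]; field_simp

/-- Flowing along a tangent vector field for the time `t`, starting at a curve of points `a t` of
the set. -/
theorem TangentToOn.exists_hasExpansion [FiniteDimensional ℝ E] {X : E → E} {F V : Set E}
    (hV : IsOpen V) (hF : ∀ x ∈ V, x ∈ closure F → x ∈ F) (hX : ContDiffOn ℝ 1 X V)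
    (hXF : TangentToOn X F V) {p : E} (hp : p ∈ V) {a : ℝ → E} {v w : E}
    (h : HasExpansion p a v w) (haF : ∀ᶠ t in 𝓝[>] 0, a t ∈ F) :
    ∃ b : ℝ → E, HasExpansion p b (v + X p)
      (w + (fderiv ℝ X p v + (2⁻¹ : ℝ) • fderiv ℝ X p (X p))) ∧ ∀ᶠ t in 𝓝[>] 0, b t ∈ F := by
  classical
  have hXp : ContDiffAt ℝ 1 X p := hX.contDiffAt (hV.mem_nhds hp)
  obtain ⟨ρ, hρ, hbound⟩ := Metric.eventually_nhds_iff_ball.1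
    (hXp.continuousAt.norm.eventually (gt_mem_nhds (lt_add_one ‖X p‖)))
  obtain ⟨r, hr, ε, hε, hflow⟩ := hXF.exists_integralCurve hV hF hX hp hρ
  choose! Γ hΓ0 hΓ using hflow
  have hev : ∀ᶠ t in 𝓝[>] (0 : ℝ), a t ∈ F ∧ a t ∈ Metric.closedBall p r ∧ t ∈ Set.Ioo 0 ε :=
    haF.and ((h.tendsto.eventually_mem (Metric.closedBall_mem_nhds p hr)).and
      (Ioo_mem_nhdsGT hε))
  refine ⟨fun t => Γ (a t) t, h.integralCurve (γ := fun t => Γ (a t)) (K := ‖X p‖ + 1)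
    (hXp.differentiableAt one_ne_zero) ?_, ?_⟩
  · filter_upwards [hev] with t ⟨h1, h2, h3⟩
    refine ⟨hΓ0 _ h1 h2, fun s hs => ?_⟩
    have := hΓ _ h1 h2 s ⟨hs.1, hs.2.trans h3.2.le⟩
    exact ⟨this.1, (hbound _ this.2.2).le⟩
  · filter_upwards [hev] with t ⟨h1, h2, h3⟩
    exact (hΓ _ h1 h2 t ⟨h3.1.le, h3.2.le⟩).2.1

/-- Without first order term `a t - p = O(t²)`, so plain differentiability of `f` gives `f (a t) - f
p = t² Df(w) + o(t²)`, and the left side is nonpositive on `F`. -/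
theorem HasExpansion.fderiv_apply_nonpos {p w : E} {F : Set E} {a : ℝ → E}
    (h : HasExpansion p a 0 w) (haF : ∀ᶠ t in 𝓝[>] 0, a t ∈ F) {f : E → ℝ}
    (hf : DifferentiableAt ℝ f p) (hfF : ∀ᶠ y in 𝓝 p, y ∈ F → f y ≤ f p) :
    fderiv ℝ f p w ≤ 0 := by
  by_contra! hpos
  have h1 : (fun t => a t - p) =O[𝓝[>] 0] fun t : ℝ => t ^ 2 := by simpa using h.sub_isBigO
  have h2 : (fun t => f (a t) - f p - fderiv ℝ f p (a t - p)) =o[𝓝[>] 0] fun t : ℝ => t ^ 2 :=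
    (hf.hasFDerivAt.isLittleO.comp_tendsto h.tendsto).trans_isBigO h1
  have h3 : (fun t => fderiv ℝ f p (a t - p - t • (0 : E) - t ^ 2 • w)) =o[𝓝[>] 0]
      fun t : ℝ => t ^ 2 := (ContinuousLinearMap.isBigO_comp _ _ _).trans_isLittleO h
  have h4 := Asymptotics.isLittleO_iff.1 (h2.add h3) (half_pos hpos)
  obtain ⟨t, ⟨⟨h5, h6⟩, h7⟩, (h8 : 0 < t)⟩ := (((h4.and haF).and
    (h.tendsto.eventually hfF)).and self_mem_nhdsWithin).exists
  have h9 := h7 h6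
  simp only [smul_zero, sub_zero, map_sub, map_smul, smul_eq_mul, norm_pow, Real.norm_eq_abs,
    abs_of_pos h8] at h5
  have h10 := (neg_le_abs _).trans h5
  nlinarith [mul_pos hpos (pow_pos h8 2)]

/-- The Lie bracket of vector fields tangent to a closed set is tangent to it. -/
theorem TangentToOn.lieBracket [FiniteDimensional ℝ E] {X Y : E → E} {F V : Set E}
    (hV : IsOpen V) (hF : ∀ x ∈ V, x ∈ closure F → x ∈ F) (hX : ContDiffOn ℝ 1 X V)
    (hY : ContDiffOn ℝ 1 Y V) (hXF : TangentToOn X F V) (hYF : TangentToOn Y F V) :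
    TangentToOn (lieBracket ℝ X Y) F V := by
  have key : ∀ X Y : E → E, ContDiffOn ℝ 1 X V → ContDiffOn ℝ 1 Y V → TangentToOn X F V →
      TangentToOn Y F V → ∀ p ∈ V, p ∈ F → ∀ f : E → ℝ, ContDiffAt ℝ 2 f p →
      (∀ᶠ y in 𝓝 p, y ∈ F → f y ≤ f p) → fderiv ℝ f p (VectorField.lieBracket ℝ X Y p) ≤ 0 := by
    intro X Y hX hY hXF hYF p hp hpF f hf hfF
    -- Start from the constant curve and flow along `X`, `Y`, `-X`, `-Y`. The velocities cancel, and
    -- the quadratic terms add up to `DY(X) - DX(Y)`.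
    have h0 : HasExpansion p (fun _ => p) 0 0 := by simp [HasExpansion]
    obtain ⟨a, ha, haF⟩ := hXF.exists_hasExpansion hV hF hX hp h0 (by simp [hpF])
    obtain ⟨b, hb, hbF⟩ := hYF.exists_hasExpansion hV hF hY hp ha haF
    obtain ⟨c, hc, hcF⟩ := hXF.neg.exists_hasExpansion hV hF hX.neg hp hb hbF
    obtain ⟨d, hd, hdF⟩ := hYF.neg.exists_hasExpansion hV hF hY.neg hp hc hcF
    have e1 : fderiv ℝ (fun x => -X x) p = -fderiv ℝ X p := fderiv_fun_neg
    have e2 : fderiv ℝ (fun x => -Y x) p = -fderiv ℝ Y p := fderiv_fun_neg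
    have hd' : HasExpansion p d 0 (VectorField.lieBracket ℝ X Y p) := by
      convert hd using 1
      · abel
      · rw [e1, e2, VectorField.lieBracket]
        simp only [zero_add, map_zero, map_add, map_neg, neg_apply, neg_neg]
        module
    exact hd'.fderiv_apply_nonpos hdF (hf.differentiableAt two_ne_zero) hfF
  intro p hp hpF f hf hfF
  -- The loop is traversed for positive times only and yields an inequality; exchanging `X` and `Y`
  -- reverses the sign of the bracket.
  refine le_antisymm (key X Y hX hY hXF hYF p hp hpF f hf hfF) ?_
  have := key Y X hY hX hYF hXF p hp hpF f hf hfF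
  rw [lieBracket_swap, map_neg] at this
  linarith

/-! ### Openness of a set without normals. -/

/-- A relatively closed set without nonzero normals is relatively open. -/
theorem mem_nhds_of_forall_fderiv_eq_zero [FiniteDimensional ℝ E] {F V : Set E}
    (hV : IsOpen V) (hF : ∀ x ∈ V, x ∈ closure F → x ∈ F)
    (h : ∀ p ∈ V, p ∈ F → ∀ f : E → ℝ, ContDiffAt ℝ 2 f p →
      (∀ᶠ y in 𝓝 p, y ∈ F → f y ≤ f p) → fderiv ℝ f p = 0) {p : E} (hp : p ∈ V) (hpF : p ∈ F) :
    F ∈ 𝓝 p := by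
  obtain ⟨R, hR, hball⟩ := Metric.nhds_basis_closedBall.mem_iff.1 (hV.mem_nhds hp)
  set G := F ∩ Metric.closedBall p R with hG
  have hGc : IsClosed G := by
    refine isClosed_of_closure_subset fun x hx => ?_
    have hxb : x ∈ Metric.closedBall p R :=
      closure_minimal Set.inter_subset_right Metric.isClosed_closedBall hx
    exact ⟨hF x (hball hxb) (closure_mono Set.inter_subset_left hx), hxb⟩
  have hpG : p ∈ G := ⟨hpF, Metric.mem_closedBall_self hR.le⟩
  refine Filter.mem_of_superset (Metric.ball_mem_nhds p (ε := R / 2) (by positivity)) fun q hq => ?_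
  obtain ⟨y, hy, hdist⟩ := hGc.exists_infDist_eq_dist ⟨p, hpG⟩ q
  have h1 : dist q y ≤ dist q p := hdist ▸ Metric.infDist_le_dist_of_mem hpG
  have hyb : y ∈ Metric.ball p R := by
    have h2 := Metric.mem_ball.1 hq
    have h3 := dist_triangle_left y p q
    rw [Metric.mem_ball]; linarith
  -- every constant vector field is tangent to `F`
  have h2 : TangentToOn (fun _ => q - y) F V := fun p hp hpF f hf hfF => by
    rw [h p hp hpF f hf hfF]; rfl
  -- The constant field `q - y` is orthogonal to the normal `q - y`, so `q = y` lies in `F`. The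
  -- radius `R / 2` for `q` puts `y` in the open ball, where nearest in `G` means locally nearest in
  -- `F`.
  have h3 := h2.inner_eq_zero (z := q) (hball (Metric.ball_subset_closedBall hyb)) hy.1 (by
    filter_upwards [Metric.isOpen_ball.mem_nhds hyb] with x hx hxF
    rw [← dist_eq_norm, ← dist_eq_norm, ← hdist]
    exact Metric.infDist_le_dist_of_mem ⟨hxF, Metric.ball_subset_closedBall hx⟩)
  rw [inner_self_eq_zero, sub_eq_zero] at h3
  exact h3 ▸ hy.1

end Euclidean

/-! ### Vector fields and functions in a chart. -/

noncomputable section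

namespace SubRiem

variable {m k l : ℕ} {M : Type*} [TopologicalSpace M]
  [ChartedSpace (EuclideanSpace ℝ (Fin m)) M]

/-- The coordinate expression of a vector field in the preferred chart at `p₀`. -/
def chartField (p₀ : M) (X : VField m M) : EuclideanSpace ℝ (Fin m) → EuclideanSpace ℝ (Fin m) :=
  mpullback 𝓘(ℝ, EuclideanSpace ℝ (Fin m)) (𝓡 m) (extChartAt (𝓡 m) p₀).symm X

/-- The coordinate expression of a function in the preferred chart at `p₀`. -/
def chartFun (p₀ : M) (w : M → ℝ) : EuclideanSpace ℝ (Fin m) → ℝ :=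
  w ∘ (extChartAt (𝓡 m) p₀).symm

/-- The level set `u = c` in the preferred chart at `p₀`. -/
def chartLevel (p₀ : M) (u : M → ℝ) (c : ℝ) : Set (EuclideanSpace ℝ (Fin m)) :=
  {z | z ∈ (extChartAt (𝓡 m) p₀).target ∧ chartFun p₀ u z = c}

/-- A linear form on the model space, applied to the coordinate expression of a field, vanishes if
it does so for fields whose values span a space containing the value of the field. -/
theorem apply_chartField_eq_zero {p₀ : M} {z : EuclideanSpace ℝ (Fin m)}
    (L : EuclideanSpace ℝ (Fin m) →L[ℝ] ℝ) {s : Set (TangentSpace (𝓡 m)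
      ((extChartAt (𝓡 m) p₀).symm z))}
    (hs : ∀ v ∈ s, ∃ X : VField m M, X ((extChartAt (𝓡 m) p₀).symm z) = v ∧
      L (chartField p₀ X z) = 0) {X : VField m M}
    (hX : X ((extChartAt (𝓡 m) p₀).symm z) ∈ Submodule.span ℝ s) :
    L (chartField p₀ X z) = 0 := by
  -- The coordinate value at `z` is a linear function of the value of the field at the corresponding
  -- point, without derivatives or regularity of the field.
  let Φ : TangentSpace (𝓡 m) ((extChartAt (𝓡 m) p₀).symm z) →L[ℝ] ℝ :=
    L ∘L (mfderiv 𝓘(ℝ, EuclideanSpace ℝ (Fin m)) (𝓡 m) (extChartAt (𝓡 m) p₀).symm z).inverse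
  have hΦ : Submodule.span ℝ s ≤ LinearMap.ker Φ.toLinearMap := Submodule.span_le.2 fun v hv => by
    obtain ⟨Y, rfl, hY⟩ := hs v hv
    exact hY
  exact hΦ hX

variable [IsManifold (𝓡 m) ∞ M]

section chart

variable {p₀ : M} {z : EuclideanSpace ℝ (Fin m)}

theorem isInvertible_mfderiv_chart_symm (hz : z ∈ (extChartAt (𝓡 m) p₀).target) :
    (mfderiv 𝓘(ℝ, EuclideanSpace ℝ (Fin m)) (𝓡 m)
      (extChartAt (𝓡 m) p₀).symm z).IsInvertible := by
  have : IsManifold (𝓡 m) 1 M := IsManifold.of_le (n := ∞) ENat.LEInfty.out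
  have h := isInvertible_mfderivWithin_extChartAt_symm (I := 𝓡 m) hz
  rwa [show Set.range (𝓡 m) = Set.univ from ModelWithCorners.range_eq_univ _,
    mfderivWithin_univ] at h

theorem contMDiffAt_chart_symm (hz : z ∈ (extChartAt (𝓡 m) p₀).target) :
    ContMDiffAt 𝓘(ℝ, EuclideanSpace ℝ (Fin m)) (𝓡 m) ∞ (extChartAt (𝓡 m) p₀).symm z :=
  (contMDiffOn_extChartAt_symm p₀).contMDiffAt ((isOpen_extChartAt_target p₀).mem_nhds hz)

theorem contDiffAt_chartField {X : VField m M} (hz : z ∈ (extChartAt (𝓡 m) p₀).target)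
    (hX : ContMDiffAt (𝓡 m) (𝓡 m).tangent ∞ (fun x => (⟨x, X x⟩ : TangentBundle (𝓡 m) M))
      ((extChartAt (𝓡 m) p₀).symm z)) : ContDiffAt ℝ ∞ (chartField p₀ X) z :=
  contMDiffAt_vectorSpace_iff_contDiffAt.1
    (ContMDiffAt.mpullback_vectorField_preimage (n := ∞) hX (contMDiffAt_chart_symm hz)
      (isInvertible_mfderiv_chart_symm hz) (by simp))

theorem differentiableAt_chartField {X : VField m M} (hz : z ∈ (extChartAt (𝓡 m) p₀).target)
    (hX : DiffAt X ((extChartAt (𝓡 m) p₀).symm z)) : DifferentiableAt ℝ (chartField p₀ X) z := by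
  have h := MDifferentiableAt.mpullback_vectorField (n := ∞) hX (contMDiffAt_chart_symm hz)
      (isInvertible_mfderiv_chart_symm hz) (by norm_cast)
  exact ((contMDiff_snd_tangentBundle_modelSpace (EuclideanSpace ℝ (Fin m))
    𝓘(ℝ, EuclideanSpace ℝ (Fin m)) (n := 1)).contMDiffAt.mdifferentiableAt one_ne_zero
    |>.comp z h).differentiableAt

theorem mfderiv_chart_symm_chartField (X : VField m M)
    (hz : z ∈ (extChartAt (𝓡 m) p₀).target) :
    mfderiv 𝓘(ℝ, EuclideanSpace ℝ (Fin m)) (𝓡 m) (extChartAt (𝓡 m) p₀).symm z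
      (chartField p₀ X z) = X ((extChartAt (𝓡 m) p₀).symm z) := by
  obtain ⟨e, he⟩ := isInvertible_mfderiv_chart_symm hz
  rw [chartField, mpullback_apply, ← he, ContinuousLinearMap.inverse_equiv]
  exact e.apply_symm_apply _

theorem fderiv_chartFun_apply {w : M → ℝ} (hz : z ∈ (extChartAt (𝓡 m) p₀).target)
    (hw : MDifferentiableAt (𝓡 m) 𝓘(ℝ, ℝ) w ((extChartAt (𝓡 m) p₀).symm z)) (X : VField m M) :
    fderiv ℝ (chartFun p₀ w) z (chartField p₀ X z) =
      mvfderiv (𝓡 m) w ((extChartAt (𝓡 m) p₀).symm z) (X ((extChartAt (𝓡 m) p₀).symm z)) := by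
  have h := mfderiv_comp z hw ((contMDiffAt_chart_symm hz).mdifferentiableAt (by simp))
  rw [← mfderiv_eq_fderiv, chartFun, h, ← mfderiv_chart_symm_chartField X hz]
  rfl

theorem contDiffAt_chartFun {w : M → ℝ} {n : ℕ∞ω} (hn : n ≤ ∞)
    (hz : z ∈ (extChartAt (𝓡 m) p₀).target)
    (hw : ContMDiffAt (𝓡 m) 𝓘(ℝ, ℝ) n w ((extChartAt (𝓡 m) p₀).symm z)) :
    ContDiffAt ℝ n (chartFun p₀ w) z :=
  (hw.comp z ((contMDiffAt_chart_symm hz).of_le hn)).contDiffAt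

/-- Naturality of the bracket under pullback by the inverse chart; on the model space the manifold
bracket is the usual one. -/
theorem chartField_mlieBracket {X Y : VField m M} (hz : z ∈ (extChartAt (𝓡 m) p₀).target)
    (hX : DiffAt X ((extChartAt (𝓡 m) p₀).symm z)) (hY : DiffAt Y ((extChartAt (𝓡 m) p₀).symm z)) :
    chartField p₀ (mlieBracket (𝓡 m) X Y) z =
      lieBracket ℝ (chartField p₀ X) (chartField p₀ Y) z := by
  have : IsManifold (𝓡 m) 2 M := IsManifold.of_le (n := ∞) ENat.LEInfty.out
  have : IsManifold (𝓡 m) (minSmoothness ℝ 3) M := by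
    rw [minSmoothness_of_isRCLikeNormedField]
    exact IsManifold.of_le (n := ∞) (by norm_cast)
  have h := mpullback_mlieBracket (n := ∞) (I := 𝓘(ℝ, EuclideanSpace ℝ (Fin m))) (I' := 𝓡 m)
    hX hY (contMDiffAt_chart_symm hz)
    (by rw [minSmoothness_of_isRCLikeNormedField]; norm_cast)
  refine Eq.trans h ?_
  rw [← mlieBracketWithin_univ, mlieBracketWithin_eq_lieBracketWithin]
  change lieBracketWithin ℝ (chartField p₀ X) (chartField p₀ Y) Set.univ z = _
  rw [lieBracketWithin_univ]

/-- The derivative of a function along a vector field, in coordinates. -/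
theorem eventually_mvfderiv_apply_eq {w : M → ℝ} {x : M} (hx : x ∈ (extChartAt (𝓡 m) p₀).source)
    (hw : ContMDiffAt (𝓡 m) 𝓘(ℝ, ℝ) 2 w x) (X : VField m M) :
    ∀ᶠ y in 𝓝 x, mvfderiv (𝓡 m) w y (X y) =
      fderiv ℝ (chartFun p₀ w) (extChartAt (𝓡 m) p₀ y) (chartField p₀ X (extChartAt (𝓡 m) p₀ y)) := by
  have : IsManifold (𝓡 m) 2 M := IsManifold.of_le (n := ∞) ENat.LEInfty.out
  filter_upwards [(isOpen_extChartAt_source p₀).mem_nhds hx,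
    (contMDiffAt_iff_contMDiffAt_nhds (by simp)).1 hw] with y hy hwy
  have h1 := (extChartAt (𝓡 m) p₀).left_inv hy
  have h2 := fderiv_chartFun_apply ((extChartAt (𝓡 m) p₀).map_source hy)
    (by rw [h1]; exact hwy.mdifferentiableAt two_ne_zero) X
  rw [h2, h1]

theorem hasFDerivAt_chartFun_chartField {w : M → ℝ} {X : VField m M} {x : M}
    (hx : x ∈ (extChartAt (𝓡 m) p₀).source)
    (hw : ContMDiffAt (𝓡 m) 𝓘(ℝ, ℝ) 2 w x) (hX : DiffAt X x) :
    HasFDerivAt (fun z => fderiv ℝ (chartFun p₀ w) z (chartField p₀ X z))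
      ((fderiv ℝ (chartFun p₀ w) (extChartAt (𝓡 m) p₀ x)).comp
        (fderiv ℝ (chartField p₀ X) (extChartAt (𝓡 m) p₀ x)) +
        (fderiv ℝ (fderiv ℝ (chartFun p₀ w)) (extChartAt (𝓡 m) p₀ x)).flip
          (chartField p₀ X (extChartAt (𝓡 m) p₀ x))) (extChartAt (𝓡 m) p₀ x) := by
  have hz := (extChartAt (𝓡 m) p₀).map_source hx
  have h1 := (extChartAt (𝓡 m) p₀).left_inv hx
  have h2 : ContDiffAt ℝ 2 (chartFun p₀ w) (extChartAt (𝓡 m) p₀ x) :=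
    contDiffAt_chartFun (by norm_cast) hz (by rwa [h1])
  have h3 := differentiableAt_chartField hz (by rwa [h1] : DiffAt X _)
  exact ((h2.fderiv_right (m := 1) (by norm_num)).differentiableAt
    one_ne_zero).hasFDerivAt.clm_apply h3.hasFDerivAt

/-- Ensures that the horizontal gradient of a C² function is a differentiable section, so that the
axioms of the connection apply to it. -/
theorem mdifferentiableAt_mvfderiv_apply {w : M → ℝ} {X : VField m M} {x : M}
    (hw : ContMDiffAt (𝓡 m) 𝓘(ℝ, ℝ) 2 w x) (hX : DiffAt X x) :
    MDifferentiableAt (𝓡 m) 𝓘(ℝ, ℝ) (fun y => mvfderiv (𝓡 m) w y (X y)) x := by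
  have hx := mem_extChartAt_source (I := 𝓡 m) x
  refine MDifferentiableAt.congr_of_eventuallyEq ?_ (eventually_mvfderiv_apply_eq hx hw X)
  exact (hasFDerivAt_chartFun_chartField hx hw hX).differentiableAt.comp_mdifferentiableAt
    ((contMDiffAt_extChartAt (n := ∞)).mdifferentiableAt (by simp))

/-- The second derivative of a function along vector fields, in coordinates. -/
theorem mvfderiv_mvfderiv_apply {w : M → ℝ} {X : VField m M} {x : M}
    (hx : x ∈ (extChartAt (𝓡 m) p₀).source)
    (hw : ContMDiffAt (𝓡 m) 𝓘(ℝ, ℝ) 2 w x) (hX : DiffAt X x) (Y : VField m M) :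
    mvfderiv (𝓡 m) (fun y => mvfderiv (𝓡 m) w y (X y)) x (Y x) =
      fderiv ℝ (fderiv ℝ (chartFun p₀ w)) (extChartAt (𝓡 m) p₀ x)
        (chartField p₀ Y (extChartAt (𝓡 m) p₀ x)) (chartField p₀ X (extChartAt (𝓡 m) p₀ x)) +
      fderiv ℝ (chartFun p₀ w) (extChartAt (𝓡 m) p₀ x)
        (fderiv ℝ (chartField p₀ X) (extChartAt (𝓡 m) p₀ x)
          (chartField p₀ Y (extChartAt (𝓡 m) p₀ x))) := by
  have hz := (extChartAt (𝓡 m) p₀).map_source hx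
  have h1 := (extChartAt (𝓡 m) p₀).left_inv hx
  have h2 := fderiv_chartFun_apply hz
    (by rw [h1]; exact mdifferentiableAt_mvfderiv_apply hw hX) Y
  rw [h1] at h2
  have h3 : chartFun p₀ (fun y => mvfderiv (𝓡 m) w y (X y)) =ᶠ[𝓝 (extChartAt (𝓡 m) p₀ x)]
      fun z => fderiv ℝ (chartFun p₀ w) z (chartField p₀ X z) := by
    have hc : Filter.Tendsto (extChartAt (𝓡 m) p₀).symm (𝓝 (extChartAt (𝓡 m) p₀ x)) (𝓝 x) := by
      have := (contMDiffAt_chart_symm hz).continuousAt.tendsto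
      rwa [h1] at this
    filter_upwards [hc.eventually (eventually_mvfderiv_apply_eq hx hw X),
      (isOpen_extChartAt_target p₀).mem_nhds hz] with z hz1 hz2
    rw [(extChartAt (𝓡 m) p₀).right_inv hz2] at hz1
    exact hz1
  rw [← h2, h3.fderiv_eq, (hasFDerivAt_chartFun_chartField hx hw hX).fderiv]
  simp [add_comm]

end chart

/-! ### Orthonormal frames, and the operator as a sum of squares with drift. -/

variable {S : SubRiemannianStructure m k M}

/-- Gram-Schmidt for smooth sections. -/
theorem SubRiemannianStructure.exists_orthonormal (S : SubRiemannianStructure m k M) {U : Set M}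
    (hU : IsOpen U) : ∀ (n : ℕ) (e : Fin n → S.Sec), (∀ i, SmoothOn (e i).toVField U) →
      (∀ x ∈ U, LinearIndependent ℝ fun i => e i x) →
      ∃ e' : Fin n → S.Sec, (∀ i, SmoothOn (e' i).toVField U) ∧
        (∀ x ∈ U, ∀ i j, S.metric x (e' i x) (e' j x) = if i = j then 1 else 0) ∧
        ∀ x ∈ U, ∀ i, e' i x ∈ Submodule.span ℝ (Set.range fun i => e i x) := by
  intro n
  induction n with
  | zero => exact fun e _ _ => ⟨e, fun i => i.elim0, fun x _ i => i.elim0, fun x _ i => i.elim0⟩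
  | succ n ih =>
    intro e he hli
    obtain ⟨f, hf, hfo, hfs⟩ := ih (fun i => e i.castSucc) (fun i => he _) fun x hx =>
      (hli x hx).comp _ (Fin.castSucc_injective n)
    let r : S.Sec := fun x => e (Fin.last n) x -
      ∑ i, S.metric x (e (Fin.last n) x) (f i x) • f i x
    have hr : SmoothOn r.toVField U := by
      have h1 : SmoothOn (fun x => (e (Fin.last n)).toVField x -
          ∑ i, S.metric x (e (Fin.last n) x) (f i x) • (f i).toVField x) U :=
        ContMDiffOn.sub_section (he _) (ContMDiffOn.sum_section fun i _ =>
          (S.smooth U hU _ _ (he _) (hf i)).smul_section (hf i))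
      refine h1.congr fun x _ => ?_
      simp [Distribution.Sec.toVField, r]
    have hr0 : ∀ x ∈ U, r x ≠ 0 := fun x hx h0 => by
      have h1 := (linearIndependent_finSucc'.1 (hli x hx)).2
      refine h1 ?_
      have h2 : e (Fin.last n) x = ∑ i, S.metric x (e (Fin.last n) x) (f i x) • f i x :=
        sub_eq_zero.1 h0
      rw [h2]
      exact Submodule.sum_mem _ fun i _ => Submodule.smul_mem _ _ (hfs x hx i)
    have hrf : ∀ x ∈ U, ∀ j, S.metric x (r x) (f j x) = 0 := fun x hx j => by
      simp [r, hfo x hx]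
    have hrs : ∀ x ∈ U, r x ∈ Submodule.span ℝ (Set.range fun i => e i x) := fun x hx => by
      refine Submodule.sub_mem _ (Submodule.subset_span ⟨_, rfl⟩)
        (Submodule.sum_mem _ fun i _ => Submodule.smul_mem _ _ ?_)
      refine Submodule.span_mono ?_ (hfs x hx i)
      rintro _ ⟨j, rfl⟩; exact ⟨_, rfl⟩
    have hpos : ∀ x ∈ U, 0 < S.metric x (r x) (r x) := fun x hx => S.pos x _ (hr0 x hx)
    let q : S.Sec := fun x => (√(S.metric x (r x) (r x)))⁻¹ • r x
    have hq : SmoothOn q.toVField U := by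
      have h1 : ContMDiffOn (𝓡 m) 𝓘(ℝ, ℝ) ∞ (fun x => (√(S.metric x (r x) (r x)))⁻¹) U :=
        fun x hx => ContDiffAt.comp_contMDiffWithinAt (g := fun t : ℝ => (√t)⁻¹)
          (f := fun x => S.metric x (r x) (r x)) ((Real.contDiffAt_sqrt (hpos x hx).ne').inv
            (Real.sqrt_pos.2 (hpos x hx)).ne') (S.smooth U hU _ _ hr hr x hx)
      exact (h1.smul_section hr).congr fun x _ => by simp [Distribution.Sec.toVField, q]
    refine ⟨Fin.snoc f q, fun i => ?_, fun x hx i j => ?_, fun x hx i => ?_⟩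
    · refine Fin.lastCases ?_ (fun i => ?_) i
      · simpa using hq
      · simpa using hf i
    · refine Fin.lastCases ?_ (fun i => ?_) i
      · refine Fin.lastCases ?_ (fun j => ?_) j
        · have h1 := Real.mul_self_sqrt (hpos x hx).le
          have h2 := (Real.sqrt_pos.2 (hpos x hx)).ne'
          simp only [Fin.snoc_last, q, map_smul, LinearMap.smul_apply, smul_eq_mul, if_true]
          nth_rewrite 3 [← h1]
          field_simp
        · simp [q, hrf x hx, (Fin.castSucc_lt_last j).ne']
      · refine Fin.lastCases ?_ (fun j => ?_) j
        · simp [q, S.symm x (f i x), hrf x hx, (Fin.castSucc_lt_last i).ne]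
        · simp [hfo x hx]
    · refine Fin.lastCases ?_ (fun i => ?_) i
      · simpa [q] using Submodule.smul_mem _ _ (hrs x hx)
      · simp only [Fin.snoc_castSucc]
        refine Submodule.span_mono ?_ (hfs x hx i)
        rintro _ ⟨j, rfl⟩; exact ⟨_, rfl⟩

/-- Smooth orthonormal frames of a sub-Riemannian structure exist locally. -/
theorem SubRiemannianStructure.exists_orthonormal_frame (S : SubRiemannianStructure m k M) (p : M) :
    ∃ U : Set M, IsOpen U ∧ p ∈ U ∧ ∃ e : Fin k → S.Sec, (∀ i, SmoothOn (e i).toVField U) ∧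
      ∀ x ∈ U, ∃ b : Basis (Fin k) ℝ (S.space x), (∀ i, b i = e i x) ∧
        ∀ i j, S.metric x (b i) (b j) = if i = j then 1 else 0 := by
  obtain ⟨e, U, hU, hp, he⟩ := S.toDistribution.exists_sec_frame p
  have hli : ∀ x ∈ U, LinearIndependent ℝ fun i => e i x := fun x hx =>
    LinearIndependent.of_comp (S.space x).subtype (he.linearIndependent x hx)
  obtain ⟨f, hf, hfo, -⟩ := S.exists_orthonormal hU k e he.smoothOn hli
  refine ⟨U, hU, hp, f, hf, fun x hx => ?_⟩
  have hrank : Fintype.card (Fin k) = finrank ℝ (S.space x) := by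
    rw [← he.span_eq x hx]
    exact (finrank_span_eq_card (he.linearIndependent x hx)).symm
  have hfli : LinearIndependent ℝ fun i => f i x := by
    rw [Fintype.linearIndependent_iff]
    intro c hc i
    have h1 : S.metric x (∑ j, c j • f j x) (f i x) = c i := by simp [hfo x hx]
    rw [hc] at h1
    simpa using h1.symm
  -- Rank 0 is separate because `basisOfLinearIndependentOfCardEqFinrank` needs a nonempty index
  -- type.
  rcases Nat.eq_zero_or_pos k with rfl | hk
  · have : Subsingleton (S.space x) := by
      rw [Submodule.subsingleton_iff_eq_bot, ← he.span_eq x hx]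
      simp
    exact ⟨Basis.empty _, fun i => i.elim0, fun i => i.elim0⟩
  · have : Nonempty (Fin k) := ⟨⟨0, hk⟩⟩
    refine ⟨basisOfLinearIndependentOfCardEqFinrank hfli hrank, fun i => by simp, fun i j => ?_⟩
    simpa using hfo x hx i j

theorem SubRiemannianStructure.metric_horizontalGradient (w : M → ℝ) (x : M) (v : S.space x) :
    S.metric x (S.horizontalGradient w x) v = mvfderiv (𝓡 m) w x v := by
  have : FiniteDimensional ℝ (TangentSpace (𝓡 m) x) :=
    inferInstanceAs (FiniteDimensional ℝ (EuclideanSpace ℝ (Fin m)))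
  exact LinearMap.BilinForm.apply_toDual_symm_apply _ _

/-- The sublaplacian in a smooth orthonormal frame. -/
theorem Complement.exists_horizontalLaplacian_eq (C : Complement S.toDistribution l) (p : M) :
    ∃ U : Set M, IsOpen U ∧ p ∈ U ∧ ∃ e : Fin k → S.Sec, (∀ i, SmoothOn (e i).toVField U) ∧
      (∀ x ∈ U, Submodule.span ℝ (Set.range fun i => (e i).toVField x) = S.space x) ∧
      ∃ b : Fin k → M → ℝ, (∀ j, ContinuousOn (b j) U) ∧
        ∀ w : M → ℝ, ∀ x ∈ U, ContMDiffAt (𝓡 m) 𝓘(ℝ, ℝ) 2 w x →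
          C.horizontalLaplacian w x =
            ∑ i, mvfderiv (𝓡 m) (fun y => mvfderiv (𝓡 m) w y ((e i).toVField y)) x
              ((e i).toVField x) + ∑ j, b j x * mvfderiv (𝓡 m) w x ((e j).toVField x) := by
  have : IsManifold (𝓡 m) 2 M := IsManifold.of_le (n := ∞) ENat.LEInfty.out
  obtain ⟨U, hU, hp, e, he, hb⟩ := S.exists_orthonormal_frame p
  have heo : ∀ x ∈ U, ∀ i j, S.metric x (e i x) (e j x) = if i = j then 1 else 0 :=
    fun x hx i j => by
      obtain ⟨b, hbe, hbo⟩ := hb x hx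
      simpa [hbe] using hbo i j
  have heD : ∀ x ∈ U, ∀ i, DiffAt (e i).toVField x := fun x hx i => (he i).diffAt hU hx
  -- The drift is `-∑ D_{e i} e i`. Its components are written with brackets of the frame because
  -- continuity is visible in this form, whereas the axioms of the connection say nothing about its
  -- regularity.
  refine ⟨U, hU, hp, e, he, fun x hx => ?_,
    fun j x => ∑ i, S.metric x (C.hbracket (e i) (e j) x) (e i x), fun j => ?_,
    fun w x hx hw => ?_⟩
  · obtain ⟨b, hbe, -⟩ := hb x hx
    have h1 := congrArg (Submodule.map (S.space x).subtype) b.span_eq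
    rw [Submodule.map_span, ← Set.range_comp, Submodule.map_top, Submodule.range_subtype] at h1
    rw [← h1]
    congr 2
    ext1 i
    simp [hbe, Distribution.Sec.toVField]
  · refine continuousOn_finsetSum _ fun i _ => fun x hx => ?_
    have h1 : ContMDiffAt (𝓡 m) (𝓡 m).tangent 1
        (fun x => (⟨x, mlieBracket (𝓡 m) (e i).toVField (e j).toVField x⟩ :
          TangentBundle (𝓡 m) M)) x := by
      have : IsManifold (𝓡 m) (minSmoothness ℝ 2) M := by
        rw [minSmoothness_of_isRCLikeNormedField]
        exact IsManifold.of_le (n := ∞) ENat.LEInfty.out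
      have : IsManifold (𝓡 m) (((⊤ : ℕ∞) : ℕ∞ω) + 1) M :=
        inferInstanceAs (IsManifold (𝓡 m) ∞ M)
      exact ContMDiffAt.mlieBracket_vectorField (n := ⊤) (m := 1)
        ((he i).contMDiffAt (hU.mem_nhds hx))
        ((he j).contMDiffAt (hU.mem_nhds hx))
        (by rw [minSmoothness_of_isRCLikeNormedField]; norm_cast)
    exact (C.diffAt_metric (C.diffAt_proj (h1.mdifferentiableAt one_ne_zero))
      (heD x hx i)).continuousAt.continuousWithinAt
  · obtain ⟨b, hbe, hbo⟩ := hb x hx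
    set D := C.horizontalConnection with hDdef
    have hD : IsHorizontalConnection S C D := C.isHorizontalConnection
    set G := S.horizontalGradient w with hGdef
    have hGe : ∀ y ∈ U, G y = ∑ i, mvfderiv (𝓡 m) w y ((e i).toVField y) • e i y :=
      fun y hy => by
        obtain ⟨b, hbe, hbo⟩ := hb y hy
        have h1 : ∀ c : Fin k → ℝ, ∀ i, S.metric y (∑ j, c j • b j) (b i) = c i :=
          fun c i => by simp [hbo]
        conv_lhs => rw [← b.sum_repr (G y)]
        refine Finset.sum_congr rfl fun i _ => ?_
        rw [hbe, ← h1 (b.repr (G y)) i, b.sum_repr, hbe, S.metric_horizontalGradient]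
        rfl
    have hGD : DiffAt G.toVField x := by
      have h1 : DiffAt (fun y => ∑ i, mvfderiv (𝓡 m) w y ((e i).toVField y) • (e i).toVField y) x :=
        MDifferentiableAt.sum_section fun i _ =>
          (mdifferentiableAt_mvfderiv_apply hw (heD x hx i)).smul_section (heD x hx i)
      refine MDifferentiableAt.congr_of_eventuallyEq h1 ?_
      filter_upwards [hU.mem_nhds hx] with y hy
      simp [Distribution.Sec.toVField, hGe y hy]
    have hconst : ∀ i j, ∀ v : TangentSpace (𝓡 m) x,
        mvfderiv (𝓡 m) (fun y => S.metric y (e i y) (e j y)) x v = 0 := fun i j v => by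
      have h1 : (fun y => S.metric y (e i y) (e j y)) =ᶠ[𝓝 x] fun _ => if i = j then 1 else 0 := by
        filter_upwards [hU.mem_nhds hx] with y hy using heo y hy i j
      have h2 : mfderiv (𝓡 m) 𝓘(ℝ, ℝ) (fun y => S.metric y (e i y) (e j y)) x = 0 := by
        rw [h1.mfderiv_eq]; exact mfderiv_const
      simp [mvfderiv, h2]
    -- The products of frame fields are constant, so `D_{e i} e i` against `e j` is minus `D_{e i} e
    -- j` against `e i`, and `D_{e j} e i` is orthogonal to `e i`. The torsion identity turns the
    -- former into the bracket.
    have hskew : ∀ i j, S.metric x (D (e i) x (e i x)) (e j x) =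
        -S.metric x (C.hbracket (e i) (e j) x) (e i x) := fun i j => by
      have h1 := hD.metric (e i) (e i) (e j) x (heD x hx i) (heD x hx i) (heD x hx j)
      have h2 := hD.metric (e j) (e i) (e i) x (heD x hx j) (heD x hx i) (heD x hx i)
      have h3 := hD.torsion (e i) (e j) x (heD x hx i) (heD x hx j)
      rw [hconst] at h1 h2
      have h4 := congrArg (fun v => S.metric x v (e i x)) h3
      simp only [map_sub, LinearMap.sub_apply] at h4
      rw [S.symm x (e i x)] at h1 h2
      change _ = S.metric x (C.hbracket (e i) (e j) x) (e i x) at h4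
      linarith
    have hdiag : ∀ i, S.metric x (D G x (e i x)) (e i x) =
        mvfderiv (𝓡 m) (fun y => mvfderiv (𝓡 m) w y ((e i).toVField y)) x ((e i).toVField x) -
          mvfderiv (𝓡 m) w x (D (e i) x (e i x)) := fun i => by
      have h1 := hD.metric (e i) G (e i) x (heD x hx i) hGD (heD x hx i)
      rw [S.metric_horizontalGradient] at h1
      have h2 : (fun y => S.metric y (G y) (e i y)) =
          fun y => mvfderiv (𝓡 m) w y ((e i).toVField y) :=
        funext fun y => S.metric_horizontalGradient w y (e i y)
      rw [h2] at h1
      change _ = _ at h1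
      exact (sub_eq_of_eq_add h1).symm
    have hdrift : ∀ i, mvfderiv (𝓡 m) w x (D (e i) x (e i x)) =
        -∑ j, S.metric x (C.hbracket (e i) (e j) x) (e i x) *
          mvfderiv (𝓡 m) w x ((e j).toVField x) := fun i => by
      have h1 := hGe x hx
      rw [← S.metric_horizontalGradient, ← hGdef, h1, S.symm]
      simp only [map_sum, map_smul, smul_eq_mul, hskew]
      rw [← Finset.sum_neg_distrib]
      exact Finset.sum_congr rfl fun j _ => by ring
    rw [Complement.horizontalLaplacian, C.horizontalDivergence_eq_sum G x b hbo]
    simp only [hbe, ← hDdef, hdiag, hdrift, sub_neg_eq_add, Finset.sum_add_distrib]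
    congr 1
    rw [Finset.sum_comm]
    exact Finset.sum_congr rfl fun j _ => by rw [Finset.sum_mul]

/-! ### The strong maximum principle on the manifold. -/

/-- Horizontal fields are tangent to the maximum set of a solution. -/
theorem Complement.tangentToOn_chartLevel (C : Complement S.toDistribution l) {u : M → ℝ}
    (hu : ContMDiff (𝓡 m) 𝓘(ℝ, ℝ) 2 u) (hΔu : ∀ x, C.horizontalLaplacian u x = 0) {c : ℝ}
    (hc : ∀ x, u x ≤ c) (p₀ : M) {X : VField m M} (hX : ∀ x, X x ∈ S.space x) :
    TangentToOn (chartField p₀ X) (chartLevel p₀ u c) (extChartAt (𝓡 m) p₀).target := by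
  intro z hz hzc f hf hfF
  obtain ⟨U, hU, hxU, e, he, hspan, b, hb, hL⟩ :=
    C.exists_horizontalLaplacian_eq ((extChartAt (𝓡 m) p₀).symm z)
  set V : Set (EuclideanSpace ℝ (Fin m)) :=
    (extChartAt (𝓡 m) p₀).target ∩ (extChartAt (𝓡 m) p₀).symm ⁻¹' U with hVdef
  have hV : IsOpen V :=
    (continuousOn_extChartAt_symm p₀).isOpen_inter_preimage (isOpen_extChartAt_target p₀) hU
  let E : Fin k → EuclideanSpace ℝ (Fin m) → EuclideanSpace ℝ (Fin m) :=
    fun i => chartField p₀ (e i).toVField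
  have hE : ∀ i, ∀ y ∈ V, ContDiffAt ℝ ∞ (E i) y := fun i y hy =>
    contDiffAt_chartField hy.1 ((he i).contMDiffAt (hU.mem_nhds hy.2))
  have hEc : ∀ i, ContinuousOn (E i) V := fun i y hy =>
    (hE i y hy).continuousAt.continuousWithinAt
  -- In coordinates `e i (e i u)` is `D²u(E i, E i) + Du(DE i (E i))`; the last term goes into the
  -- drift.
  let B : EuclideanSpace ℝ (Fin m) → EuclideanSpace ℝ (Fin m) := fun y =>
    ∑ i, fderiv ℝ (E i) y (E i y) + ∑ j, b j ((extChartAt (𝓡 m) p₀).symm y) • E j y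
  have hB : ContinuousOn B V := by
    refine (continuousOn_finsetSum _ fun i _ => ?_).add (continuousOn_finsetSum _ fun j _ => ?_)
    · exact ContinuousOn.clm_apply (fun y hy => (((hE i y hy).fderiv_right (m := 0)
        (by norm_num)).continuousAt.continuousWithinAt)) (hEc i)
    · exact ((hb j).comp ((continuousOn_extChartAt_symm p₀).mono Set.inter_subset_left)
        fun y hy => hy.2).smul (hEc j)
  have huV : ContDiffOn ℝ 2 (chartFun p₀ u) V := fun y hy =>
    (contDiffAt_chartFun (by norm_cast) hy.1 (hu _)).contDiffWithinAt
  have hLu : ∀ y ∈ V, sumSq E B (chartFun p₀ u) y = 0 := fun y hy => by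
    have hs := (extChartAt (𝓡 m) p₀).map_target hy.1
    have hr := (extChartAt (𝓡 m) p₀).right_inv hy.1
    have h1 := hL u _ hy.2 (hu _)
    rw [hΔu] at h1
    have h2 : ∀ i, _ := fun i => mvfderiv_mvfderiv_apply hs (hu _)
      ((he i).diffAt hU hy.2) (e i).toVField
    have h3 : ∀ i, _ := fun i => fderiv_chartFun_apply hy.1
      ((hu _).mdifferentiableAt two_ne_zero) (e i).toVField
    rw [hr] at h2
    simp only [h2, ← h3] at h1
    rw [sumSq, h1]
    simp only [B, E, map_add, map_sum, map_smul, smul_eq_mul, Finset.sum_add_distrib]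
    ring
  refine apply_chartField_eq_zero (fderiv ℝ f z) (s := Set.range fun i =>
    (e i).toVField ((extChartAt (𝓡 m) p₀).symm z)) ?_ (by rw [hspan _ hxU]; exact hX _)
  rintro _ ⟨i, rfl⟩
  refine ⟨(e i).toVField, rfl, ?_⟩
  refine fderiv_apply_eq_zero_of_sumSq_eq_zero hV hEc hB huV hLu (fun y _ => hc _) ⟨hz, hxU⟩
    hzc.2 hf ?_ i
  filter_upwards [hfF, (isOpen_extChartAt_target p₀).mem_nhds hz] with y hy hyt hyc
    using hy ⟨hyt, hyc⟩

/-- Closures in the model space may leave the chart's target, so the level set is closed only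
relative to it; flow invariance is stated for such sets. -/
theorem mem_chartLevel_of_mem_closure {u : M → ℝ} (hu : ContMDiff (𝓡 m) 𝓘(ℝ, ℝ) 2 u) (c : ℝ)
    (p₀ : M) : ∀ z ∈ (extChartAt (𝓡 m) p₀).target, z ∈ closure (chartLevel p₀ u c) →
      z ∈ chartLevel p₀ u c := by
  intro z hz hcl
  refine ⟨hz, ?_⟩
  by_contra hne
  have h1 : ContinuousAt (chartFun p₀ u) z :=
    (contDiffAt_chartFun (n := 2) (by norm_cast) hz (hu _)).continuousAt
  obtain ⟨y, hy, hyc⟩ := mem_closure_iff_nhds.1 hcl _ (h1.eventually_ne hne)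
  exact hy hyc.2

/-- The commutators of horizontal fields are smooth and tangent to the maximum set of a
solution. -/
theorem Distribution.IsCommutator.tangentToOn_chartLevel (C : Complement S.toDistribution l)
    {u : M → ℝ} (hu : ContMDiff (𝓡 m) 𝓘(ℝ, ℝ) 2 u)
    (hΔu : ∀ x, C.horizontalLaplacian u x = 0) {c : ℝ} (hc : ∀ x, u x ≤ c) (p₀ : M) {n : ℕ}
    {X : VField m M} (hX : S.toDistribution.IsCommutator n X) :
    SmoothOn X Set.univ ∧
      TangentToOn (chartField p₀ X) (chartLevel p₀ u c) (extChartAt (𝓡 m) p₀).target := by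
  have hm : IsManifold (𝓡 m) (minSmoothness ℝ 2) M := by
    rw [minSmoothness_of_isRCLikeNormedField]
    exact IsManifold.of_le (n := ∞) ENat.LEInfty.out
  have hm' : IsManifold (𝓡 m) (((⊤ : ℕ∞) : ℕ∞ω) + 1) M := inferInstanceAs (IsManifold (𝓡 m) ∞ M)
  -- Smoothness is carried along with tangency, since the bracket step flows along both fields and
  -- needs them C¹ in the chart.
  induction hX with
  | section_ X hX => exact ⟨hX, C.tangentToOn_chartLevel hu hΔu hc p₀ fun x => (X x).2⟩
  | @bracket i j X Y hX hY ihX ihY =>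
    have hsm : ∀ {Z : VField m M}, SmoothOn Z Set.univ → ContDiffOn ℝ 1 (chartField p₀ Z)
        (extChartAt (𝓡 m) p₀).target := fun {Z} hZ z hz =>
      ((contDiffAt_chartField hz (hZ.contMDiffAt Filter.univ_mem)).of_le
        (by norm_cast)).contDiffWithinAt
    refine ⟨fun x _ => ?_, fun z hz hzc f hf hfF => ?_⟩
    · exact (ContMDiffAt.mlieBracket_vectorField (n := ⊤) (m := ⊤)
        (ihX.1.contMDiffAt Filter.univ_mem) (ihY.1.contMDiffAt Filter.univ_mem)
        (by rw [minSmoothness_of_isRCLikeNormedField]; norm_cast)).contMDiffWithinAt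
    · rw [chartField_mlieBracket hz (ihX.1.diffAt isOpen_univ trivial)
        (ihY.1.diffAt isOpen_univ trivial)]
      exact TangentToOn.lieBracket (isOpen_extChartAt_target p₀)
        (mem_chartLevel_of_mem_closure hu c p₀) (hsm ihX.1) (hsm ihY.1) ihX.2 ihY.2 z hz hzc f hf hfF

/-- The strong maximum principle. -/
theorem Complement.isOpen_setOf_eq_max (C : Complement S.toDistribution l) (hS : S.Hormander)
    {u : M → ℝ} (hu : ContMDiff (𝓡 m) 𝓘(ℝ, ℝ) 2 u)
    (hΔu : ∀ x, C.horizontalLaplacian u x = 0) {c : ℝ} (hc : ∀ x, u x ≤ c) :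
    IsOpen {x | u x = c} := by
  rw [isOpen_iff_mem_nhds]
  intro p₀ hp₀
  have hs := mem_extChartAt_source (I := 𝓡 m) p₀
  have hnhds : chartLevel p₀ u c ∈ 𝓝 (extChartAt (𝓡 m) p₀ p₀) := by
    refine mem_nhds_of_forall_fderiv_eq_zero (isOpen_extChartAt_target p₀)
      (mem_chartLevel_of_mem_closure hu c p₀) ?_ (mem_extChartAt_target p₀)
      ⟨mem_extChartAt_target p₀, by simpa [chartFun] using hp₀⟩
    intro z hz hzc f hf hfF
    obtain ⟨r, hr⟩ := hS ((extChartAt (𝓡 m) p₀).symm z)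
    ext v
    -- A field with coordinate value `v` at `z`. Only its value at that one point matters, so it may
    -- be taken as the same model vector everywhere.
    let X : VField m M := fun x =>
      (mfderiv 𝓘(ℝ, EuclideanSpace ℝ (Fin m)) (𝓡 m) (extChartAt (𝓡 m) p₀).symm z v :
        EuclideanSpace ℝ (Fin m))
    have hXv : chartField p₀ X z = v := by
      obtain ⟨e, he⟩ := isInvertible_mfderiv_chart_symm hz
      change (mfderiv 𝓘(ℝ, EuclideanSpace ℝ (Fin m)) (𝓡 m) (extChartAt (𝓡 m) p₀).symm z).inverse
        (mfderiv 𝓘(ℝ, EuclideanSpace ℝ (Fin m)) (𝓡 m) (extChartAt (𝓡 m) p₀).symm z v) = v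
      rw [← he, ContinuousLinearMap.inverse_equiv]
      exact e.symm_apply_apply _
    rw [← hXv]
    refine apply_chartField_eq_zero (fderiv ℝ f z) (s := {v | ∃ i ≤ r, ∃ X : VField m M,
      S.IsCommutator i X ∧ X ((extChartAt (𝓡 m) p₀).symm z) = v}) ?_ ?_
    · rintro v ⟨i, -, Y, hY, rfl⟩
      exact ⟨Y, rfl, (hY.tangentToOn_chartLevel C hu hΔu hc p₀).2 z hz hzc f hf hfF⟩
    · change _ ∈ S.flag r _
      rw [hr]; trivial
  filter_upwards [(continuousAt_extChartAt p₀).preimage_mem_nhds hnhds,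
    (isOpen_extChartAt_source p₀).mem_nhds hs] with x hx hxs
  have h1 : u ((extChartAt (𝓡 m) p₀).symm (extChartAt (𝓡 m) p₀ x)) = c := hx.2
  rwa [(extChartAt (𝓡 m) p₀).left_inv hxs] at h1

end SubRiem

end

theorem mainTheorem5 {m k : ℕ} {M : Type*} [TopologicalSpace M] [T2Space M] [CompactSpace M]
    [ConnectedSpace M] [ChartedSpace (EuclideanSpace ℝ (Fin m)) M] [IsManifold (𝓡 m) ∞ M]
    (S : SubRiem.SubRiemannianStructure m k M) (hS : S.Hormander)
    (Δ : (M → ℝ) → (M → ℝ)) (hΔ : S.IsSublaplacian Δ)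
    (u : M → ℝ) (hu : ContMDiff (𝓡 m) 𝓘(ℝ, ℝ) 2 u) (hΔu : ∀ x, Δ u x = 0) :
    ∃ c : ℝ, ∀ x, u x = c := by
  obtain ⟨l, C, -, rfl⟩ := hΔ
  obtain ⟨p, -, hp⟩ := isCompact_univ.exists_isMaxOn Set.univ_nonempty hu.continuous.continuousOn
  refine ⟨u p, fun x => ?_⟩
  have hopen := C.isOpen_setOf_eq_max hS hu hΔu fun x => hp (Set.mem_univ x)
  have hclosed : IsClosed {x | u x = u p} := isClosed_eq hu.continuous continuous_const
  have huniv := IsClopen.eq_univ ⟨hclosed, hopen⟩ ⟨p, rfl⟩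
  exact huniv.ge (Set.mem_univ x)
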